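/- Let $d\in\mathbb N$ and let $m=m^+-m^-$ be a real-valued, not necessarily finite, Radon measure on $\mathbb R^d$ (with $m^\pm$ mutually singular positive Radon measures, $|m|=m^++m^-$). For real $\eta,\beta$ write $(\mathrm B_{\eta,\beta})$ for the condition $$\int |f|^2\,d|m| \le \eta\Big(\int|\nabla f|^2\,dx+\beta\int|f|^2\,dx\Big)\qquad\text{for all } f\in C_0^\infty(\mathbb R^d).$$ Assume that for every $\eta>0$ there is $\beta_\eta<\infty$ such that $(\mathrm B_{\eta,\beta_\eta})$ holds. Let $J_m:H^1(\mathbb R^d)\to L^2(|m|)$ be the unique bounded linear map with $J_mf=f$ for $f\in C_0^\infty(\mathbb R^d)$. For $\varepsilon\ge 0$ let $-\Delta+\varepsilon^2\Delta^2+m$ be the operator in $L^2(\mathbb R^d,dx)$ associated with the quadratic form $$f\mapsto \varepsilon^2\|\Delta f\|^2+\|\nabla f\|^2+\int |J_mf|^2\,dm$$ with domain $H^2(\mathbb R^d)$ if $\varepsilon>0$ and $H^1(\mathbb R^d)$ if $\varepsilon=0$. Then: 1. For every $\varepsilon\ge0$ the operator $-\Delta+\varepsilon^2\Delta^2+m$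 is self-adjoint, and $-\Delta+\varepsilon^2\Delta^2+m\to-\Delta+m$ in the norm resolvent sense as $\varepsilon\downarrow0$. 2. Let $\alpha>0$ be such that $(\mathrm B_{c,\alpha})$ holds for some $c<1$. Then $-\alpha$ belongs to the resolvent set of $-\Delta+\varepsilon^2\Delta^2+m$ for every $\varepsilon\ge0$. For $\varepsilon>0$ with $4\varepsilon^2\alpha<1$ put $\beta(\varepsilon)=\dfrac{1+\sqrt{1-4\varepsilon^2\alpha}}{2\varepsilon^2}$. There is a finite constant $C$ such that, for all such $\varepsilon$ and every real $\eta$ for which $(\mathrm B_{\eta,\beta(\varepsilon)})$ holds, $$\big\|(-\Delta+\varepsilon^2\Delta^2+m+\alpha)^{-1}-(-\Delta+m+\alpha)^{-1}\big\|\le C(\varepsilon^2+\eta),$$ and there are numbers $\eta(\varepsilon)$ such that $(\mathrm B_{\eta(\varepsilon),\beta(\varepsilon)})$ holds for all such $\varepsilon$ and $\eta(\varepsilon)\to0$ as $\varepsilon\downarrow0$. -/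

import Mathlib

open MeasureTheory Filter Topology FourierTransform
open scoped ENNReal ComplexConjugate Distributions

noncomputable section

namespace MeasurePerturbation

/-! ### Unbounded operators: forms, resolvents, norm resolvent convergence -/

section Abstract

variable {H : Type*} [NormedAddCommGroup H] [InnerProductSpace ℂ H]

/-- The graph of the operator associated with a sesquilinear form `q` with form domain `D`:
`(u, w)` is in the graph iff `u ∈ D` and `q(v, u) = ⟪v, w⟫` for all `v ∈ D`
(forms and inner products are conjugate linear in the first variable). -/
def formGraph (D : Submodule ℂ H) (q : D →ₗ⋆[ℂ] D →ₗ[ℂ] ℂ) : Submodule ℂ (H × H) where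
  carrier := {x | ∃ hu : x.1 ∈ D, ∀ v : D, q v ⟨x.1, hu⟩ = inner ℂ (v : H) x.2}
  add_mem' := by
    rintro ⟨u, w⟩ ⟨u', w'⟩ ⟨hu, h⟩ ⟨hu', h'⟩
    refine ⟨D.add_mem hu hu', fun v => ?_⟩
    have e : (⟨u + u', D.add_mem hu hu'⟩ : D) = ⟨u, hu⟩ + ⟨u', hu'⟩ := rfl
    change q v ⟨u + u', D.add_mem hu hu'⟩ = inner ℂ (v : H) (w + w')
    rw [e, map_add, inner_add_right, ← h v, ← h' v]
  zero_mem' := by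
    refine ⟨D.zero_mem, fun v => ?_⟩
    change q v 0 = inner ℂ (v : H) 0
    simp
  smul_mem' := by
    rintro c ⟨u, w⟩ ⟨hu, h⟩
    refine ⟨D.smul_mem c hu, fun v => ?_⟩
    have e : (⟨c • u, D.smul_mem c hu⟩ : D) = c • ⟨u, hu⟩ := rfl
    change q v ⟨c • u, D.smul_mem c hu⟩ = inner ℂ (v : H) (c • w)
    rw [e, map_smul, inner_smul_right, ← h v, smul_eq_mul]

/-- The operator associated with a (densely defined) sesquilinear form. -/
def formOperator (D : Submodule ℂ H) (q : D →ₗ⋆[ℂ] D →ₗ[ℂ] ℂ) : H →ₗ.[ℂ] H :=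
  (formGraph D q).toLinearPMap

/-- `R` is the bounded everywhere defined inverse `(A - z)⁻¹` of `A - z`. -/
def IsResolventOf (A : H →ₗ.[ℂ] H) (z : ℂ) (R : H →L[ℂ] H) : Prop :=
  (∀ f : H, ∃ h : R f ∈ A.domain, A ⟨R f, h⟩ - z • R f = f) ∧
    ∀ u : A.domain, R (A u - z • (u : H)) = u

/-- The resolvent set of an unbounded operator. -/
def resolventSetOf (A : H →ₗ.[ℂ] H) : Set ℂ := {z | ∃ R : H →L[ℂ] H, IsResolventOf A z R}

open Classical in
/-- The resolvent `(A - z)⁻¹` (with the value `0` for `z` outside of the resolvent set). -/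
def resolventOf (A : H →ₗ.[ℂ] H) (z : ℂ) : H →L[ℂ] H :=
  if h : ∃ R : H →L[ℂ] H, IsResolventOf A z R then h.choose else 0

/-- Convergence in the norm resolvent sense: `(A i - z)⁻¹ → (A₀ - z)⁻¹` in operator norm for every
non-real `z`. -/
def NormResolventTendsto {ι : Type*} (A : ι → H →ₗ.[ℂ] H) (l : Filter ι) (A₀ : H →ₗ.[ℂ] H) :
    Prop :=
  ∀ z : ℂ, z.im ≠ 0 →
    (∀ᶠ i in l, z ∈ resolventSetOf (A i)) ∧ z ∈ resolventSetOf A₀ ∧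
      Tendsto (fun i => resolventOf (A i) z) l (𝓝 (resolventOf A₀ z))

end Abstract

/-! ### Real Radon measures and the form bound -/

/-- The Euclidean space `ℝ^d`. -/
abbrev Space (d : ℕ) : Type := EuclideanSpace ℝ (Fin d)

/-- A real-valued (not necessarily finite) Radon measure `m = m⁺ - m⁻` on `ℝ^d`, given by its
Hahn-Jordan decomposition: two mutually singular positive Radon measures. -/
structure RealRadonMeasure (d : ℕ) where
  pos : Measure (Space d)
  neg : Measure (Space d)
  regular_pos : pos.Regular
  regular_neg : neg.Regular
  mutuallySingular : pos ⟂ₘ neg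

attribute [instance] RealRadonMeasure.regular_pos RealRadonMeasure.regular_neg

variable {d : ℕ}

/-- The total variation measure `|m| = m⁺ + m⁻`. -/
def RealRadonMeasure.abs (m : RealRadonMeasure d) : Measure (Space d) := m.pos + m.neg

instance (m : RealRadonMeasure d) : IsFiniteMeasureOnCompacts m.abs where
  lt_top_of_isCompact K hK := by
    simp only [RealRadonMeasure.abs, Measure.add_apply]
    exact ENNReal.add_lt_top.2 ⟨hK.measure_lt_top, hK.measure_lt_top⟩

/-- Complex-valued smooth functions with compact support on `ℝ^d`. -/
abbrev Test (d : ℕ) : Type := 𝓓((⊤ : TopologicalSpace.Opens (Space d)), ℂ)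

/-- The form bound
`∫ |f|² d|m| ≤ η (∫ |∇f|² dx + β ∫ |f|² dx)` for all smooth `f` with compact support. -/
def FormBound (m : RealRadonMeasure d) (η β : ℝ) : Prop :=
  ∀ f : Test d,
    ∫ x, ‖f x‖ ^ 2 ∂m.abs ≤
      η * ((∫ x, ∑ i, ‖fderiv ℝ (f : Space d → ℂ) x (EuclideanSpace.single i 1)‖ ^ 2)
        + β * ∫ x, ‖f x‖ ^ 2)

/-! ### Sobolev spaces -/

/-- `L²(ℝ^d, dx)`. -/
abbrev L2 (d : ℕ) : Type := Lp ℂ 2 (volume : Measure (Space d))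

/-- The weight `(1 + p²)^(s/2)`. Mathlib's Fourier transform is normalized with `exp(-2πi x·ξ)`,
so the momentum variable is `p = 2πξ` throughout. -/
def sobolevWeight (s : ℝ) (ξ : Space d) : ℝ := (1 + (2 * Real.pi * ‖ξ‖) ^ 2) ^ (s / 2)

/-- The `H^s` norm `(∫ (1 + p²)^s |û(p)|² dp)^(1/2)`, possibly infinite. -/
def sobolevENorm (s : ℝ) (u : L2 d) : ℝ≥0∞ :=
  eLpNorm (fun ξ => (sobolevWeight s ξ : ℂ) * (𝓕 u : L2 d) ξ) 2 volume

theorem sobolevWeight_pos (s : ℝ) (ξ : Space d) : 0 < sobolevWeight s ξ := by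
  unfold sobolevWeight; positivity

theorem continuous_sobolevWeight (s : ℝ) : Continuous (sobolevWeight (d := d) s) := by
  unfold sobolevWeight
  refine Continuous.rpow_const (by fun_prop) fun ξ => Or.inl ?_
  positivity

theorem aestronglyMeasurable_weight (s : ℝ) (u : L2 d) :
    AEStronglyMeasurable (fun ξ => (sobolevWeight s ξ : ℂ) * (𝓕 u : L2 d) ξ) volume :=
  (Complex.continuous_ofReal.comp (continuous_sobolevWeight s)).aestronglyMeasurable.mul
    (Lp.aestronglyMeasurable _)

/-- The Sobolev space `H^s(ℝ^d)`, as a subspace of `L²(ℝ^d)`. -/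
def sobolev (d : ℕ) (s : ℝ) : Submodule ℂ (L2 d) where
  carrier := {u | sobolevENorm s u < ∞}
  add_mem' := by
    intro u v hu hv
    have h := eLpNorm_add_lt_top (p := 2) (μ := (volume : Measure (Space d)))
      ⟨aestronglyMeasurable_weight s u, hu⟩ ⟨aestronglyMeasurable_weight s v, hv⟩
    refine lt_of_le_of_lt (le_of_eq (eLpNorm_congr_ae ?_)) h
    rw [FourierTransform.fourier_add]
    filter_upwards [Lp.coeFn_add (𝓕 u : L2 d) (𝓕 v : L2 d)] with ξ hξ
    simp only [hξ, Pi.add_apply, mul_add]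
  zero_mem' := by
    have h : eLpNorm (0 : Space d → ℂ) 2 volume < ∞ := by simp
    refine lt_of_le_of_lt (le_of_eq (eLpNorm_congr_ae ?_)) h
    rw [FourierTransform.fourier_zero]
    filter_upwards [Lp.coeFn_zero ℂ 2 (volume : Measure (Space d))] with ξ hξ
    simp only [hξ, Pi.zero_apply, mul_zero]
  smul_mem' := by
    intro c u hu
    have h := (MemLp.const_smul (p := 2) (μ := (volume : Measure (Space d)))
      ⟨aestronglyMeasurable_weight s u, hu⟩ c).2
    refine lt_of_le_of_lt (le_of_eq (eLpNorm_congr_ae ?_)) h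
    rw [FourierTransform.fourier_smul]
    filter_upwards [Lp.coeFn_smul c (𝓕 u : L2 d)] with ξ hξ
    simp only [hξ, Pi.smul_apply, smul_eq_mul]
    ring

theorem memLp_of_mem_sobolev {s : ℝ} {u : L2 d} (hu : u ∈ sobolev d s) :
    MemLp (fun ξ => (sobolevWeight s ξ : ℂ) * (𝓕 u : L2 d) ξ) 2 volume :=
  ⟨aestronglyMeasurable_weight s u, hu⟩

theorem sobolev_mono {s t : ℝ} (h : s ≤ t) : sobolev d t ≤ sobolev d s := by
  intro u hu
  refine ((memLp_of_mem_sobolev hu).mono (aestronglyMeasurable_weight s u)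
    (Eventually.of_forall fun ξ => ?_)).2
  rw [norm_mul, norm_mul]
  refine mul_le_mul_of_nonneg_right ?_ (norm_nonneg _)
  rw [Complex.norm_real, Complex.norm_real, Real.norm_of_nonneg (sobolevWeight_pos s ξ).le,
    Real.norm_of_nonneg (sobolevWeight_pos t ξ).le]
  unfold sobolevWeight
  exact Real.rpow_le_rpow_of_exponent_le (by nlinarith [sq_nonneg (2 * Real.pi * ‖ξ‖)])
    (by linarith)

/-! ### The free forms -/

/-- The form domain of `-Δ + ε²Δ²`: it is `H¹` if `ε = 0` and `H²` otherwise. -/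
def formDomain (d : ℕ) (ε : ℝ) : Submodule ℂ (L2 d) := sobolev d (if ε = 0 then 1 else 2)

theorem formDomain_le (ε : ℝ) : formDomain d ε ≤ sobolev d 1 := by
  unfold formDomain
  split_ifs
  · exact le_rfl
  · exact sobolev_mono (by norm_num)

/-- The symbol `p² + ε² p⁴` of `-Δ + ε²Δ²`, with `p = 2πξ`. -/
def symbol (ε : ℝ) (ξ : Space d) : ℝ :=
  (2 * Real.pi * ‖ξ‖) ^ 2 + ε ^ 2 * (2 * Real.pi * ‖ξ‖) ^ 4

theorem integrable_freeForm (ε : ℝ) {u v : L2 d} (hv : v ∈ formDomain d ε)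
    (hu : u ∈ formDomain d ε) :
    Integrable (fun ξ => (symbol ε ξ : ℂ) *
      (conj ((𝓕 v : L2 d) ξ) * (𝓕 u : L2 d) ξ)) volume := by
  unfold formDomain at hu hv
  set s : ℝ := if ε = 0 then 1 else 2 with hs
  have hU := (memLp_of_mem_sobolev hu).norm
  have hV := (memLp_of_mem_sobolev hv).norm
  have hI := (hV.integrable_mul hU).const_mul (1 + ε ^ 2)
  refine hI.mono ?_ (Eventually.of_forall fun ξ => ?_)
  · refine AEStronglyMeasurable.mul ?_ (AEStronglyMeasurable.mul
      (Complex.continuous_conj.comp_aestronglyMeasurable (Lp.aestronglyMeasurable _))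
      (Lp.aestronglyMeasurable _))
    refine (Complex.continuous_ofReal.comp ?_).aestronglyMeasurable
    unfold symbol
    fun_prop
  · have hw : symbol ε ξ ≤ (1 + ε ^ 2) * (sobolevWeight s ξ * sobolevWeight s ξ) := by
      have hq : (0 : ℝ) ≤ (2 * Real.pi * ‖ξ‖) ^ 2 := sq_nonneg _
      have h1 : sobolevWeight s ξ * sobolevWeight s ξ = (1 + (2 * Real.pi * ‖ξ‖) ^ 2) ^ s := by
        unfold sobolevWeight
        rw [← Real.rpow_add (by positivity)]
        congr 1
        ring
      rw [h1, hs]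
      unfold symbol
      set q : ℝ := (2 * Real.pi * ‖ξ‖) ^ 2 with hq'
      have h4 : (2 * Real.pi * ‖ξ‖) ^ 4 = q ^ 2 := by rw [hq']; ring
      rw [h4]
      split_ifs with h0
      · simp [h0]
      · rw [Real.rpow_two]
        nlinarith [sq_nonneg ε, mul_nonneg (sq_nonneg ε) hq, sq_nonneg q]
    have hs0 : 0 ≤ symbol ε ξ := by unfold symbol; positivity
    simp only [norm_mul, Complex.norm_real, RCLike.norm_conj, Real.norm_of_nonneg hs0,
      Pi.mul_apply, Real.norm_of_nonneg (sobolevWeight_pos s ξ).le, norm_norm]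
    rw [Real.norm_of_nonneg (by positivity : (0 : ℝ) ≤ 1 + ε ^ 2)]
    calc symbol ε ξ * (‖(𝓕 v : L2 d) ξ‖ * ‖(𝓕 u : L2 d) ξ‖)
        ≤ (1 + ε ^ 2) * (sobolevWeight s ξ * sobolevWeight s ξ) *
          (‖(𝓕 v : L2 d) ξ‖ * ‖(𝓕 u : L2 d) ξ‖) :=
          mul_le_mul_of_nonneg_right hw (by positivity)
      _ = _ := by ring

/-- The form of `-Δ + ε²Δ²`:
`(v, u) ↦ ε² (Δv, Δu) + (∇v, ∇u) = ∫ (p² + ε² p⁴) conj(v̂(p)) û(p) dp`. -/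
def freeForm (d : ℕ) (ε : ℝ) : formDomain d ε →ₗ⋆[ℂ] formDomain d ε →ₗ[ℂ] ℂ :=
  LinearMap.mk₂'ₛₗ (starRingEnd ℂ) (RingHom.id ℂ)
    (fun v u => ∫ ξ, (symbol ε ξ : ℂ) *
      (conj ((𝓕 (v : L2 d) : L2 d) ξ) * (𝓕 (u : L2 d) : L2 d) ξ))
    (by
      intro v v' u
      rw [← integral_add (integrable_freeForm ε v.2 u.2) (integrable_freeForm ε v'.2 u.2)]
      refine integral_congr_ae ?_
      rw [Submodule.coe_add, FourierTransform.fourier_add]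
      filter_upwards [Lp.coeFn_add (𝓕 (v : L2 d) : L2 d) (𝓕 (v' : L2 d) : L2 d)] with ξ hξ
      simp only [hξ, Pi.add_apply, map_add]
      ring)
    (by
      intro c v u
      rw [smul_eq_mul, ← integral_const_mul]
      refine integral_congr_ae ?_
      rw [Submodule.coe_smul, FourierTransform.fourier_smul]
      filter_upwards [Lp.coeFn_smul c (𝓕 (v : L2 d) : L2 d)] with ξ hξ
      simp only [hξ, Pi.smul_apply, smul_eq_mul, map_mul]
      ring)
    (by
      intro v u u'
      rw [← integral_add (integrable_freeForm ε v.2 u.2) (integrable_freeForm ε v.2 u'.2)]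
      refine integral_congr_ae ?_
      rw [Submodule.coe_add, FourierTransform.fourier_add]
      filter_upwards [Lp.coeFn_add (𝓕 (u : L2 d) : L2 d) (𝓕 (u' : L2 d) : L2 d)] with ξ hξ
      simp only [hξ, Pi.add_apply]
      ring)
    (by
      intro c v u
      rw [RingHom.id_apply, smul_eq_mul, ← integral_const_mul]
      refine integral_congr_ae ?_
      rw [Submodule.coe_smul, FourierTransform.fourier_smul]
      filter_upwards [Lp.coeFn_smul c (𝓕 (u : L2 d) : L2 d)] with ξ hξ
      simp only [hξ, Pi.smul_apply, smul_eq_mul]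
      ring)

/-! ### The trace map and the perturbed forms -/

/-- A test function is square integrable with respect to every measure that is finite on compact
sets. -/
theorem memLp_test (f : Test d) (μ : Measure (Space d)) [IsFiniteMeasureOnCompacts μ] :
    MemLp (f : Space d → ℂ) 2 μ :=
  f.continuous.memLp_of_hasCompactSupport f.hasCompactSupport

/-- `J : H¹(ℝ^d) → L²(|m|)` is bounded and satisfies `J f = f` for all smooth `f` with compact
support. -/
def IsTraceMap (m : RealRadonMeasure d) (J : sobolev d 1 →ₗ[ℂ] Lp ℂ 2 m.abs) : Prop :=
  (∃ C : ℝ, ∀ u : sobolev d 1, ‖J u‖ ≤ C * (sobolevENorm 1 (u : L2 d)).toReal) ∧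
    ∀ (f : Test d) (hf : (memLp_test f volume).toLp (f : Space d → ℂ) ∈ sobolev d 1),
      J ⟨_, hf⟩ = (memLp_test f m.abs).toLp (f : Space d → ℂ)

open Classical in
/-- The map `J_m : H¹(ℝ^d) → L²(|m|)`. It is unique by density of the smooth compactly supported
functions in `H¹(ℝ^d)`, and it exists as soon as `FormBound m η β` holds for some `η` and `β`
(if there is no such map, the value is `0`). -/
def traceMap (m : RealRadonMeasure d) : sobolev d 1 →ₗ[ℂ] Lp ℂ 2 m.abs :=
  if h : ∃ J, IsTraceMap m J then h.choose else 0

theorem integrable_pairing {μ ν : Measure (Space d)} (h : μ ≤ ν) (a b : Lp ℂ 2 ν) :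
    Integrable (fun x => conj (b x) * a x) μ := by
  have ha : MemLp (a : Space d → ℂ) 2 μ := (Lp.memLp a).mono_measure h
  have hb : MemLp (b : Space d → ℂ) 2 μ := (Lp.memLp b).mono_measure h
  exact MemLp.integrable_mul hb.star ha

/-- `∫ conj(b) a dμ` on `L²(ν)`, for a measure `μ ≤ ν`. -/
def pairing {μ ν : Measure (Space d)} (h : μ ≤ ν) : Lp ℂ 2 ν →ₗ⋆[ℂ] Lp ℂ 2 ν →ₗ[ℂ] ℂ :=
  LinearMap.mk₂'ₛₗ (starRingEnd ℂ) (RingHom.id ℂ) (fun b a => ∫ x, conj (b x) * a x ∂μ)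
    (by
      intro b b' a
      rw [← integral_add (integrable_pairing h a b) (integrable_pairing h a b')]
      refine integral_congr_ae ?_
      filter_upwards [(Measure.absolutelyContinuous_of_le h).ae_le (Lp.coeFn_add b b')] with x hx
      simp only [hx, Pi.add_apply, map_add]
      ring)
    (by
      intro c b a
      rw [smul_eq_mul, ← integral_const_mul]
      refine integral_congr_ae ?_
      filter_upwards [(Measure.absolutelyContinuous_of_le h).ae_le (Lp.coeFn_smul c b)] with x hx
      simp only [hx, Pi.smul_apply, smul_eq_mul, map_mul]
      ring)
    (by
      intro b a a'
      rw [← integral_add (integrable_pairing h a b) (integrable_pairing h a' b)]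
      refine integral_congr_ae ?_
      filter_upwards [(Measure.absolutelyContinuous_of_le h).ae_le (Lp.coeFn_add a a')] with x hx
      simp only [hx, Pi.add_apply]
      ring)
    (by
      intro c b a
      rw [RingHom.id_apply, smul_eq_mul, ← integral_const_mul]
      refine integral_congr_ae ?_
      filter_upwards [(Measure.absolutelyContinuous_of_le h).ae_le (Lp.coeFn_smul c a)] with x hx
      simp only [hx, Pi.smul_apply, smul_eq_mul]
      ring)

theorem RealRadonMeasure.pos_le_abs (m : RealRadonMeasure d) : m.pos ≤ m.abs :=
  Measure.le_add_right le_rfl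

theorem RealRadonMeasure.neg_le_abs (m : RealRadonMeasure d) : m.neg ≤ m.abs :=
  Measure.le_add_left le_rfl

/-- `∫ conj(b) a dm = ∫ conj(b) a dm⁺ - ∫ conj(b) a dm⁻` on `L²(|m|)`. -/
def RealRadonMeasure.form (m : RealRadonMeasure d) :
    Lp ℂ 2 m.abs →ₗ⋆[ℂ] Lp ℂ 2 m.abs →ₗ[ℂ] ℂ :=
  pairing m.pos_le_abs - pairing m.neg_le_abs

/-- The trace map on the form domain of `-Δ + ε²Δ²`. -/
def formTrace (m : RealRadonMeasure d) (ε : ℝ) : formDomain d ε →ₗ[ℂ] Lp ℂ 2 m.abs :=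
  (traceMap m).comp (Submodule.inclusion (formDomain_le ε))

/-- The form of `-Δ + ε²Δ² + m`:
`(v, u) ↦ ε² (Δv, Δu) + (∇v, ∇u) + ∫ conj(J_m v) (J_m u) dm`. -/
def perturbedForm (m : RealRadonMeasure d) (ε : ℝ) :
    formDomain d ε →ₗ⋆[ℂ] formDomain d ε →ₗ[ℂ] ℂ :=
  freeForm d ε + (m.form.comp (formTrace m ε)).compl₂ (formTrace m ε)

/-- The operator `-Δ + ε²Δ² + m` in `L²(ℝ^d)`. -/
def schrodinger (m : RealRadonMeasure d) (ε : ℝ) : L2 d →ₗ.[ℂ] L2 d :=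
  formOperator (formDomain d ε) (perturbedForm m ε)

/-- `β(ε) = (1 + √(1 - 4ε²α)) / (2ε²)`, where `-β(ε)` is the root of smaller value of
`ε² x² + x + α`. -/
def betaParam (α ε : ℝ) : ℝ := (1 + √(1 - 4 * ε ^ 2 * α)) / (2 * ε ^ 2)

end MeasurePerturbation

end

open MeasureTheory Filter Topology FourierTransform
open scoped ENNReal ComplexConjugate Distributions

noncomputable section

namespace MeasurePerturbation

/-! ### Operators given by a bounded self-adjoint injective inverse -/

section Abstract

variable {H : Type*} [NormedAddCommGroup H] [InnerProductSpace ℂ H]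

/-! Let `(B_{c,α})` hold with `c < 1` and put `G = (-Δ + α)^(-1/2)`, `T = J_m G` and `B = T* S T`,
where `S` is the contraction on `L²(|m|)` that represents `m`. The form bound says exactly that
`‖T‖² ≤ c`, so `‖B‖ ≤ c < 1`. On vectors `Gv`, `Gu` the form of `-Δ + m + α` is `⟪v, (1 + B)u⟫`,
hence `-Δ + m` has the inverse `G (1 + B)⁻¹ G` at `-α`. This inverse is bounded, self-adjoint and
injective, which yields self-adjointness and the resolvents at all non-real points
(`isShiftedInverseGraph_formGraph`, `IsShiftedInverseGraph.isSelfAdjoint`). For `ε > 0` one replaces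
`G` by `GK` and `B` by `KBK`, where the multiplier `K = (p² + α)^(1/2) (p² + ε²p⁴ + α)^(-1/2)` is a
contraction commuting with `G`.

The rate comes from the multiplier `E = ε p² (p² + ε²p⁴ + α)^(-1/2)`, for which `K² + E² = 1`. With
`U = (1 + K²B)⁻¹` and `V = (1 + B)⁻¹` the difference of the two inverses is `-(G U E)(E V G)`. The
defect `E` occurs once in each factor. It meets either `G`, where `‖EG‖ ≤ ε`, or `B`, where `‖BE‖ ≤
‖T‖ ‖TE‖ ≤ √η` by `(B_{η,β(ε)})` and `ε²β(ε) ≤ 1`. Each factor is therefore `O(ε + √η)` and the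
product is `O(ε² + η)` (`norm_perturbedInverse_sub_le`, `exists_shiftedInverse`). The optimal `η`
for `β(ε)` tends to zero because `β(ε) → ∞`, and convergence at one real point gives norm resolvent
convergence (`normResolventTendsto_of_tendsto`).

The form bound is assumed on test functions only. It reaches `T` because `(1 - Δ)^(1/2)` maps them
onto a dense subspace of `L²` (`denseRange_besselTest`, `exists_traceMap_factor`). -/

theorem IsResolventOf.unique {A : H →ₗ.[ℂ] H} {z : ℂ} {R S : H →L[ℂ] H}
    (hR : IsResolventOf A z R) (hS : IsResolventOf A z S) : R = S := by
  ext f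
  obtain ⟨h, hf⟩ := hR.1 f
  have := hS.2 ⟨R f, h⟩
  rw [hf] at this
  exact this.symm

theorem IsResolventOf.resolventOf_eq {A : H →ₗ.[ℂ] H} {z : ℂ} {R : H →L[ℂ] H}
    (hR : IsResolventOf A z R) : resolventOf A z = R := by
  have h : ∃ R : H →L[ℂ] H, IsResolventOf A z R := ⟨R, hR⟩
  rw [resolventOf, dif_pos h]
  exact h.choose_spec.unique hR

/-- The relation `g` is the graph of `R⁻¹ - a`. -/
def IsShiftedInverseGraph (g : Submodule ℂ (H × H)) (a : ℝ) (R : H →L[ℂ] H) : Prop :=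
  ∀ u w : H, (u, w) ∈ g ↔ u = R (w + (a : ℂ) • u)

namespace IsShiftedInverseGraph

variable {g : Submodule ℂ (H × H)} {a : ℝ} {R : H →L[ℂ] H}

theorem mem (hg : IsShiftedInverseGraph g a R) (f : H) : (R f, f - (a : ℂ) • R f) ∈ g := by
  rw [hg]; simp

/-- Injectivity of `R` makes the relation single-valued, which is what guarantees that
`toLinearPMap` has `g` itself as its graph. -/
theorem snd_eq_zero (hg : IsShiftedInverseGraph g a R) (hinj : ∀ f, R f = 0 → f = 0) :
    ∀ x ∈ g, x.1 = 0 → x.2 = 0 := by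
  rintro ⟨u, w⟩ hx (rfl : u = 0)
  have := (hg 0 w).1 hx
  exact hinj w (by simpa using this.symm)

theorem mem_domain (hg : IsShiftedInverseGraph g a R) (f : H) :
    R f ∈ g.toLinearPMap.domain :=
  ⟨_, hg.mem f, rfl⟩

theorem isSelfAdjoint [CompleteSpace H] (hg : IsShiftedInverseGraph g a R)
    (hinj : ∀ f, R f = 0 → f = 0) (hR : IsSelfAdjoint R) : IsSelfAdjoint g.toLinearPMap := by
  have hsym : ∀ x y, inner ℂ (R x) y = inner ℂ x (R y) :=
    ContinuousLinearMap.isSelfAdjoint_iff_isSymmetric.1 hR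
  -- The domain contains the range of `R`, and the orthogonal complement of that range is the kernel
  -- of the self-adjoint `R`.
  have hdense : Dense (g.toLinearPMap.domain : Set H) := by
    rw [Submodule.dense_iff_topologicalClosure_eq_top,
      Submodule.topologicalClosure_eq_top_iff, Submodule.eq_bot_iff]
    intro x hx
    refine hinj x (ext_inner_left ℂ fun f => ?_)
    rw [← hsym, inner_zero_right]
    exact (Submodule.mem_orthogonal _ _).1 hx _ (hg.mem_domain f)
  rw [LinearPMap.isSelfAdjoint_def]
  apply LinearPMap.eq_of_eq_graph
  rw [LinearPMap.adjoint_graph_eq_graph_adjoint hdense,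
    Submodule.toLinearPMap_graph_eq g (hg.snd_eq_zero hinj)]
  ext ⟨u, w⟩
  rw [Submodule.mem_adjoint_iff, hg]
  constructor
  · intro h
    refine ext_inner_left ℂ fun f => ?_
    -- The pairs `(R f, f - a R f)` suffice as test vectors for the adjoint: since `a` is real, they
    -- give `u = R (w + a u)` directly.
    have := h _ _ (hg.mem f)
    simp only [inner_sub_left, inner_smul_left, Complex.conj_ofReal] at this
    rw [← hsym, inner_add_right, inner_smul_right]
    linear_combination this
  · intro h x y hxy
    have hx := (hg x y).1 hxy
    have h1 : inner ℂ (y + (a : ℂ) • x) u = inner ℂ x (w + (a : ℂ) • u) := by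
      conv_lhs => rw [h]
      conv_rhs => rw [hx]
      rw [hsym]
    simp only [inner_add_left, inner_add_right, inner_smul_left, inner_smul_right,
      Complex.conj_ofReal] at h1
    simp only
    linear_combination h1

/-- Formally `A = R⁻¹ - a`, so `A - z = (1 - (z + a) R) R⁻¹` and the resolvent is `(1 - (z + a) R)⁻¹
R`. The two hypotheses express this without an inverse; at `z = -a` they hold with `S = R`. -/
theorem isResolventOf (hg : IsShiftedInverseGraph g a R) (hinj : ∀ f, R f = 0 → f = 0)
    {z : ℂ} {S : H →L[ℂ] H} (h₁ : (1 - (z + a) • R) * S = R) (h₂ : S * (1 - (z + a) • R) = R) :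
    IsResolventOf g.toLinearPMap z S := by
  have hgr := Submodule.toLinearPMap_graph_eq g (hg.snd_eq_zero hinj)
  constructor
  · intro f
    have hmem : (S f, f + z • S f) ∈ g.toLinearPMap.graph := by
      rw [hgr, hg]
      have e := congrArg (fun T : H →L[ℂ] H => T f) h₁
      simp only [mul_apply_eq_comp, sub_apply,
        one_apply_eq_self, smul_apply] at e
      rw [sub_eq_iff_eq_add] at e
      rw [add_assoc, ← add_smul, map_add, map_smul]
      exact e
    obtain ⟨y, hy, hy'⟩ := (LinearPMap.mem_graph_iff _).1 hmem
    simp only at hy hy'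
    refine ⟨hy ▸ y.2, ?_⟩
    have : (⟨S f, hy ▸ y.2⟩ : g.toLinearPMap.domain) = y := Subtype.ext hy.symm
    rw [this, hy']
    simp
  · intro u
    have hmem : ((u : H), g.toLinearPMap u) ∈ g := by
      exact hgr.le (LinearPMap.mem_graph _ u)
    have hu := (hg _ _).1 hmem
    have e := congrArg (fun T : H →L[ℂ] H => T (g.toLinearPMap u + (a : ℂ) • (u : H))) h₂
    simp only [mul_apply_eq_comp, sub_apply,
      one_apply_eq_self, smul_apply, ← hu] at e
    convert e using 2
    rw [add_smul]
    abel

theorem isResolventOf_neg (hg : IsShiftedInverseGraph g a R) (hinj : ∀ f, R f = 0 → f = 0) :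
    IsResolventOf g.toLinearPMap (-a) R :=
  hg.isResolventOf hinj (by simp) (by simp)

end IsShiftedInverseGraph

/-- The spectrum of `R` is real, `ζ⁻¹` is not, and `1 - ζR = ζ (ζ⁻¹ - R)`. -/
theorem isUnit_one_sub_smul [CompleteSpace H] {R : H →L[ℂ] H} (hR : IsSelfAdjoint R) {ζ : ℂ}
    (hζ : ζ.im ≠ 0) : IsUnit (1 - ζ • R) := by
  have h0 : ζ ≠ 0 := by rintro rfl; simp at hζ
  have h : ζ⁻¹ ∉ spectrum ℂ R := by
    intro h
    have := congrArg Complex.im (hR.mem_spectrum_eq_re h)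
    rw [Complex.ofReal_im, Complex.inv_im] at this
    have h2 : Complex.normSq ζ ≠ 0 := by simpa using h0
    field_simp at this
    exact hζ (by simpa using this)
  rw [spectrum.notMem_iff] at h
  have e : (1 - ζ • R) = (Units.mk0 ζ h0) • (algebraMap ℂ (H →L[ℂ] H) ζ⁻¹ - R) := by
    rw [Units.smul_def, Units.val_mk0, smul_sub, Algebra.algebraMap_eq_smul_one, smul_smul,
      mul_inv_cancel₀ h0, one_smul]
  rw [e]
  exact h.smul _

theorem IsShiftedInverseGraph.isResolventOf_of_im_ne_zero [CompleteSpace H]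
    {g : Submodule ℂ (H × H)} {a : ℝ} {R : H →L[ℂ] H} (hg : IsShiftedInverseGraph g a R)
    (hinj : ∀ f, R f = 0 → f = 0) (hR : IsSelfAdjoint R) {z : ℂ} (hz : z.im ≠ 0) :
    IsResolventOf g.toLinearPMap z (Ring.inverse (1 - (z + a) • R) * R) := by
  have hu : IsUnit (1 - (z + a) • R) := isUnit_one_sub_smul hR (by simpa using hz)
  refine hg.isResolventOf hinj ?_ ?_
  · rw [← mul_assoc, Ring.mul_inverse_cancel _ hu, one_mul]
  · have hc : R * (1 - (z + a) • R) = (1 - (z + a) • R) * R := by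
      simp [mul_sub, sub_mul]
    rw [mul_assoc, hc, ← mul_assoc, Ring.inverse_mul_cancel _ hu, one_mul]

/-- Norm convergence of the resolvents at one real point implies norm resolvent convergence. -/
theorem normResolventTendsto_of_tendsto [CompleteSpace H] {ι : Type*} {l : Filter ι}
    {g : ι → Submodule ℂ (H × H)} {g₀ : Submodule ℂ (H × H)} {a : ℝ} {R : ι → H →L[ℂ] H}
    {R₀ : H →L[ℂ] H} (hg : ∀ᶠ i in l, IsShiftedInverseGraph (g i) a (R i) ∧
      (∀ f, R i f = 0 → f = 0) ∧ IsSelfAdjoint (R i))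
    (hg₀ : IsShiftedInverseGraph g₀ a R₀) (hinj₀ : ∀ f, R₀ f = 0 → f = 0)
    (hR₀ : IsSelfAdjoint R₀) (hlim : Tendsto R l (𝓝 R₀)) :
    NormResolventTendsto (fun i => (g i).toLinearPMap) l g₀.toLinearPMap := by
  intro z hz
  have h₀ := hg₀.isResolventOf_of_im_ne_zero hinj₀ hR₀ hz
  refine ⟨?_, ⟨_, h₀⟩, ?_⟩
  · filter_upwards [hg] with i hi
    exact ⟨_, hi.1.isResolventOf_of_im_ne_zero hi.2.1 hi.2.2 hz⟩
  · rw [h₀.resolventOf_eq]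
    have hu : IsUnit (1 - (z + a) • R₀) := isUnit_one_sub_smul hR₀ (by simpa using hz)
    -- All resolvents at `z` are the same expression in the inverses at `-a`, so continuity of
    -- inversion at a unit transfers the limit.
    have hc : ContinuousAt Ring.inverse (1 - (z + a) • R₀) := by
      obtain ⟨u, hu⟩ := hu
      rw [← hu]; exact NormedRing.inverse_continuousAt u
    have hl : Tendsto (fun i => 1 - (z + a) • R i) l (𝓝 (1 - (z + a) • R₀)) :=
      tendsto_const_nhds.sub (hlim.const_smul _)
    refine ((hc.tendsto.comp hl).mul hlim).congr' ?_
    filter_upwards [hg] with i hi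
    exact (hi.1.isResolventOf_of_im_ne_zero hi.2.1 hi.2.2 hz).resolventOf_eq.symm

/-! ### Form perturbations of a bounded inverse -/

/-- The inverse `G (1 + B)⁻¹ G` of the operator with form `⟪G⁻¹v, G⁻¹u⟫ + ⟪G⁻¹v, B G⁻¹u⟫`. -/
def perturbedInverse (G B : H →L[ℂ] H) : H →L[ℂ] H := G * Ring.inverse (1 + B) * G

theorem isUnit_one_add [CompleteSpace H] {B : H →L[ℂ] H} (hB : ‖B‖ < 1) : IsUnit (1 + B) := by
  have := isUnit_one_sub_of_norm_lt_one (x := -B) (by rwa [norm_neg])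
  rwa [sub_neg_eq_add] at this

theorem norm_inverse_one_add_le [CompleteSpace H] {B : H →L[ℂ] H} {c : ℝ} (hc : c < 1)
    (hB : ‖B‖ ≤ c) : ‖Ring.inverse (1 + B)‖ ≤ 1 / (1 - c) := by
  have hu := isUnit_one_add (hB.trans_lt hc)
  set V := Ring.inverse (1 + B)
  have e : V = 1 - B * V := by
    rw [eq_sub_iff_add_eq]
    have := Ring.mul_inverse_cancel _ hu
    rwa [add_mul, one_mul] at this
  have h1 : ‖V‖ ≤ 1 + c * ‖V‖ := by
    calc ‖V‖ = ‖1 - B * V‖ := congrArg _ e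
      _ ≤ ‖(1 : H →L[ℂ] H)‖ + ‖B * V‖ := norm_sub_le _ _
      -- Only `‖1‖ ≤ 1` is used, so the trivial space is covered.
      _ ≤ 1 + c * ‖V‖ := add_le_add ContinuousLinearMap.norm_id_le
        ((norm_mul_le _ _).trans (mul_le_mul_of_nonneg_right hB (norm_nonneg _)))
  rw [le_div_iff₀ (by linarith)]
  linarith

theorem perturbedInverse_isSelfAdjoint [CompleteSpace H] {G B : H →L[ℂ] H}
    (hG : IsSelfAdjoint G) (hB : IsSelfAdjoint B) : IsSelfAdjoint (perturbedInverse G B) := by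
  have h := (((IsSelfAdjoint.one (H →L[ℂ] H)).add hB).ringInverse).conjugate G
  rwa [hG.star_eq] at h

theorem perturbedInverse_injective [CompleteSpace H] {G B : H →L[ℂ] H}
    (hG : ∀ f, G f = 0 → f = 0) (hB : ‖B‖ < 1) : ∀ f, perturbedInverse G B f = 0 → f = 0 := by
  intro f hf
  apply hG
  have h1 : Ring.inverse (1 + B) (G f) = 0 := hG _ hf
  have h2 := congrArg (fun T : H →L[ℂ] H => T (G f))
    (Ring.mul_inverse_cancel _ (isUnit_one_add hB))
  simp only [mul_apply_eq_comp, one_apply_eq_self] at h2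
  rw [← h2, h1, map_zero]

/-- By `hq`, the shifted form satisfies `q(Gv, Gf) + a⟪Gv, Gf⟫ = ⟪v, (1 + B)f⟫`. For `u = Gf` the
weak equation against all `Gv` thus reads `(1 + B)f = G(w + a u)`. Since `G` maps onto the form
domain, no test vector is lost. -/
theorem isShiftedInverseGraph_formGraph [CompleteSpace H] {D : Submodule ℂ H}
    {q : D →ₗ⋆[ℂ] D →ₗ[ℂ] ℂ} {G B : H →L[ℂ] H} {a : ℝ} (hG : IsSelfAdjoint G) (hB : ‖B‖ < 1)
    (hmem : ∀ f, G f ∈ D) (hsurj : ∀ u ∈ D, ∃ f, G f = u)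
    (hq : ∀ f f', q ⟨G f, hmem f⟩ ⟨G f', hmem f'⟩ =
      inner ℂ f f' - a * inner ℂ (G f) (G f') + inner ℂ f (B f')) :
    IsShiftedInverseGraph (formGraph D q) a (perturbedInverse G B) := by
  have hsym : ∀ x y, inner ℂ (G x) y = inner ℂ x (G y) :=
    ContinuousLinearMap.isSelfAdjoint_iff_isSymmetric.1 hG
  have hu := isUnit_one_add hB
  intro u w
  constructor
  · rintro ⟨huD, h⟩
    obtain ⟨f, rfl⟩ := hsurj u huD
    have h1 : (1 + B) f = G (w + (a : ℂ) • G f) := by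
      refine ext_inner_left ℂ fun v => ?_
      have h2 := (hq v f).symm.trans (h ⟨G v, hmem v⟩)
      simp only [add_apply, one_apply_eq_self, inner_add_right]
      rw [← hsym, inner_add_right, inner_smul_right]
      linear_combination h2
    simp only [perturbedInverse, mul_apply_eq_comp]
    rw [← h1, ← mul_apply_eq_comp (Ring.inverse (1 + B)),
      Ring.inverse_mul_cancel _ hu, one_apply_eq_self]
  · intro h
    set f := Ring.inverse (1 + B) (G (w + (a : ℂ) • u)) with hf
    have hGf : u = G f := h
    have h1 : (1 + B) f = G (w + (a : ℂ) • u) := by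
      rw [hf, ← mul_apply_eq_comp (1 + B), Ring.mul_inverse_cancel _ hu,
        one_apply_eq_self]
    refine ⟨hGf ▸ hmem f, fun v => ?_⟩
    obtain ⟨v, hv⟩ := v
    obtain ⟨v', rfl⟩ := hsurj v hv
    have e : (⟨u, hGf ▸ hmem f⟩ : D) = ⟨G f, hmem f⟩ := Subtype.ext hGf
    change q _ ⟨u, _⟩ = inner ℂ (G v') w
    rw [e, hq]
    have h2 := congrArg (inner ℂ v') h1
    simp only [add_apply, one_apply_eq_self, inner_add_right]
      at h2
    rw [← hsym, inner_add_right, inner_smul_right, hGf] at h2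
    linear_combination h2

/-- Comparison of `G (1 + B)⁻¹ G` and `G K (1 + K B K)⁻¹ K G`, where `K² + E² = 1`. -/
theorem norm_perturbedInverse_sub_le [CompleteSpace H] {G B K E : H →L[ℂ] H} {c s t : ℝ}
    (hc : c < 1) (hB : ‖B‖ ≤ c) (hK : ‖K‖ ≤ 1) (hKG : Commute K G) (hKE : K * K + E * E = 1)
    (hEG : ‖E * G‖ ≤ s) (hGE : ‖G * E‖ ≤ s) (hEB : ‖E * B‖ ≤ t) (hBE : ‖B * E‖ ≤ t) :
    ‖perturbedInverse (G * K) (K * B * K) - perturbedInverse G B‖ ≤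
      (s + ‖G‖ / (1 - c) * t) ^ 2 := by
  have hKK : ‖K * K‖ ≤ 1 :=
    (norm_mul_le _ _).trans (mul_le_one₀ hK (norm_nonneg _) hK)
  have hc0 : 0 ≤ c := (norm_nonneg B).trans hB
  have ht0 : 0 ≤ t := (norm_nonneg _).trans hEB
  have hs0 : 0 ≤ s := (norm_nonneg _).trans hEG
  have hB1 : ‖K * K * B‖ ≤ c := (norm_mul_le _ _).trans
    ((mul_le_of_le_one_left (norm_nonneg _) hKK).trans hB)
  have hB2 : ‖K * B * K‖ ≤ c := by
    refine (norm_mul_le _ _).trans ((mul_le_of_le_one_right (norm_nonneg _) hK).trans ?_)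
    exact (norm_mul_le _ _).trans ((mul_le_of_le_one_left (norm_nonneg _) hK).trans hB)
  set V := Ring.inverse (1 + B) with hV
  set U := Ring.inverse (1 + K * K * B) with hU
  set W := Ring.inverse (1 + K * B * K) with hW
  have hVn := norm_inverse_one_add_le hc hB
  have hUn := norm_inverse_one_add_le hc hB1
  have V1 : (1 + B) * V = 1 := Ring.mul_inverse_cancel _ (isUnit_one_add (hB.trans_lt hc))
  have U1 : (1 + K * K * B) * U = 1 :=
    Ring.mul_inverse_cancel _ (isUnit_one_add (hB1.trans_lt hc))
  have U2 : U * (1 + K * K * B) = 1 :=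
    Ring.inverse_mul_cancel _ (isUnit_one_add (hB1.trans_lt hc))
  have W1 : (1 + K * B * K) * W = 1 :=
    Ring.mul_inverse_cancel _ (isUnit_one_add (hB2.trans_lt hc))
  -- This is `K (1 + KBK) = (1 + K²B) K` with the inverses moved to the other sides.
  have push : K * W = U * K := by
    calc K * W = U * (1 + K * K * B) * (K * W) := by rw [U2, one_mul]
      _ = U * K * ((1 + K * B * K) * W) := by noncomm_ring
      _ = U * K := by rw [W1, mul_one]
  -- A second resolvent identity: between `G U` and `V G` stands `K²(1 + B) - (1 + K²B) = K² - 1 =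
  -- -E²`. Splitting `E²` evenly makes both factors small.
  have key : perturbedInverse (G * K) (K * B * K) - perturbedInverse G B =
      -((G * U * E) * (E * V * G)) := by
    have e1 : perturbedInverse (G * K) (K * B * K) = G * U * (K * K) * G := by
      unfold perturbedInverse
      rw [← hW]
      calc G * K * W * (G * K) = G * (K * W) * (G * K) := by noncomm_ring
        _ = G * U * K * (G * K) := by rw [push]; noncomm_ring
        _ = G * U * (K * K) * G := by rw [← hKG.eq]; noncomm_ring
    have e2 : perturbedInverse G B = G * V * G := rfl
    have e3 : E * E = 1 - K * K := by rw [← hKE]; abel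
    have e4 : (G * U * E) * (E * V * G) = G * U * (E * E) * V * G := by noncomm_ring
    rw [e1, e2, e4, e3]
    calc G * U * (K * K) * G - G * V * G
        = G * U * (K * K) * ((1 + B) * V) * G - G * (U * (1 + K * K * B)) * V * G := by
          rw [V1, U2]; noncomm_ring
      _ = _ := by noncomm_ring
  have b1 : ‖E * V * G‖ ≤ s + ‖G‖ / (1 - c) * t := by
    -- Here `V = 1 - BV` brings `E` next to `G` or `B`. For the other factor `U = 1 - U K² B` does
    -- the same.
    have e : E * V * G = E * G - E * B * V * G := by
      calc E * V * G = E * ((1 + B) * V) * G - E * B * V * G := by noncomm_ring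
        _ = _ := by rw [V1]; noncomm_ring
    rw [e]
    refine (norm_sub_le _ _).trans (add_le_add hEG ?_)
    calc ‖E * B * V * G‖ ≤ ‖E * B‖ * ‖V‖ * ‖G‖ :=
          (norm_mul_le _ _).trans (mul_le_mul_of_nonneg_right (norm_mul_le _ _) (norm_nonneg _))
      _ ≤ t * (1 / (1 - c)) * ‖G‖ := by gcongr
      _ = _ := by ring
  have b2 : ‖G * U * E‖ ≤ s + ‖G‖ / (1 - c) * t := by
    have e : G * U * E = G * E - G * U * (K * K) * (B * E) := by
      calc G * U * E = G * (U * (1 + K * K * B)) * E - G * U * (K * K) * (B * E) := by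
            noncomm_ring
        _ = _ := by rw [U2]; noncomm_ring
    rw [e]
    refine (norm_sub_le _ _).trans (add_le_add hGE ?_)
    calc ‖G * U * (K * K) * (B * E)‖ ≤ ‖G‖ * ‖U‖ * ‖K * K‖ * ‖B * E‖ := by
          refine (norm_mul_le _ _).trans (mul_le_mul_of_nonneg_right ?_ (norm_nonneg _))
          refine (norm_mul_le _ _).trans (mul_le_mul_of_nonneg_right ?_ (norm_nonneg _))
          exact norm_mul_le _ _
      _ ≤ ‖G‖ * (1 / (1 - c)) * 1 * t := by gcongr
      _ = _ := by ring
  rw [key, norm_neg, sq]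
  exact (norm_mul_le _ _).trans (mul_le_mul b2 b1 (norm_nonneg _) ((norm_nonneg _).trans b1))

end Abstract

/-! ### Bounded Fourier multipliers -/

section Multipliers

variable {d : ℕ}

theorem norm_sq_eq_integral_norm_sq {μ : Measure (Space d)} (u : Lp ℂ 2 μ) :
    ‖u‖ ^ 2 = ∫ x, ‖u x‖ ^ 2 ∂μ := by
  have h : inner ℂ u u = ((∫ x, ‖u x‖ ^ 2 ∂μ : ℝ) : ℂ) := by
    rw [L2.inner_def, ← integral_complex_ofReal]
    refine integral_congr_ae (Eventually.of_forall fun x => ?_)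
    simp only
    rw [inner_self_eq_norm_sq_to_K]
    simp
  apply Complex.ofReal_injective
  rw [← h, inner_self_eq_norm_sq_to_K]
  simp

theorem integrable_norm_sq {μ : Measure (Space d)} (u : Lp ℂ 2 μ) :
    Integrable (fun x => ‖u x‖ ^ 2) μ :=
  (memLp_two_iff_integrable_sq_norm (Lp.aestronglyMeasurable u)).1 (Lp.memLp u)

theorem eq_of_fourier_ae_eq {u v : L2 d}
    (h : ((𝓕 u : L2 d) : Space d → ℂ) =ᵐ[volume] (𝓕 v : L2 d)) : u = v := by
  have h1 : (𝓕 u : L2 d) = 𝓕 v := Lp.ext h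
  have h2 := congrArg (fun w : L2 d => (𝓕⁻ w : L2 d)) h1
  simpa only [FourierTransform.fourierInv_fourier_eq] using h2

theorem fourier_add_ae (u v : L2 d) : ((𝓕 (u + v) : L2 d) : Space d → ℂ) =ᵐ[volume]
    fun ξ => (𝓕 u : L2 d) ξ + (𝓕 v : L2 d) ξ := by
  rw [FourierTransform.fourier_add]
  exact Lp.coeFn_add _ _

theorem fourier_smul_ae (c : ℂ) (u : L2 d) : ((𝓕 (c • u) : L2 d) : Space d → ℂ) =ᵐ[volume]
    fun ξ => c * (𝓕 u : L2 d) ξ := by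
  rw [FourierTransform.fourier_smul]
  exact Lp.coeFn_smul _ _

/-- The function in `L²` with Fourier transform `f`. -/
def ofFourier {f : Space d → ℂ} (hf : MemLp f 2 volume) : L2 d := 𝓕⁻ (hf.toLp f)

theorem fourier_ofFourier {f : Space d → ℂ} (hf : MemLp f 2 volume) :
    ((𝓕 (ofFourier hf) : L2 d) : Space d → ℂ) =ᵐ[volume] f := by
  rw [ofFourier, FourierTransform.fourier_fourierInv_eq]
  exact hf.coeFn_toLp

theorem memLp_mul_fourier (φ : BoundedContinuousFunction (Space d) ℝ) (u : L2 d) :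
    MemLp (fun ξ => (φ ξ : ℂ) * (𝓕 u : L2 d) ξ) 2 volume := by
  refine MemLp.of_le_mul (c := ‖φ‖) (Lp.memLp (𝓕 u : L2 d)) ?_ (Eventually.of_forall fun ξ => ?_)
  · exact (Complex.continuous_ofReal.comp φ.continuous).aestronglyMeasurable.mul
      (Lp.aestronglyMeasurable _)
  · rw [norm_mul, Complex.norm_real]
    exact mul_le_mul_of_nonneg_right (φ.norm_coe_le_norm ξ) (norm_nonneg _)

theorem norm_ofFourier_le {u : L2 d} {φ : Space d → ℝ} {C : ℝ}
    (h : MemLp (fun ξ => (φ ξ : ℂ) * (𝓕 u : L2 d) ξ) 2 volume)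
    (hφ : ∀ ξ, |φ ξ| ≤ C) : ‖ofFourier h‖ ≤ C * ‖u‖ := by
  rw [← Lp.norm_fourier_eq (ofFourier h), ← Lp.norm_fourier_eq u]
  refine Lp.norm_le_mul_norm_of_ae_le_mul ?_
  filter_upwards [fourier_ofFourier h] with ξ hξ
  rw [hξ, norm_mul, Complex.norm_real]
  exact mul_le_mul_of_nonneg_right (hφ ξ) (norm_nonneg _)

/-- The Fourier multiplier with a bounded continuous real symbol. -/
def fourierMul (φ : BoundedContinuousFunction (Space d) ℝ) : L2 d →L[ℂ] L2 d :=
  LinearMap.mkContinuous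
    { toFun := fun u => ofFourier (memLp_mul_fourier φ u)
      map_add' := fun u v => by
        apply eq_of_fourier_ae_eq
        filter_upwards [fourier_ofFourier (memLp_mul_fourier φ (u + v)),
          fourier_ofFourier (memLp_mul_fourier φ u), fourier_ofFourier (memLp_mul_fourier φ v),
          fourier_add_ae u v, fourier_add_ae (ofFourier (memLp_mul_fourier φ u))
            (ofFourier (memLp_mul_fourier φ v))] with ξ a1 a2 a3 a4 a5
        rw [a1, a5, a2, a3, a4, mul_add]
      map_smul' := fun c u => by
        apply eq_of_fourier_ae_eq
        rw [RingHom.id_apply]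
        filter_upwards [fourier_ofFourier (memLp_mul_fourier φ (c • u)),
          fourier_ofFourier (memLp_mul_fourier φ u), fourier_smul_ae c u,
          fourier_smul_ae c (ofFourier (memLp_mul_fourier φ u))] with ξ a1 a2 a3 a4
        rw [a1, a4, a2, a3]
        ring }
    ‖φ‖ (fun u => norm_ofFourier_le _ fun ξ => φ.norm_coe_le_norm ξ)

theorem fourier_fourierMul (φ : BoundedContinuousFunction (Space d) ℝ) (u : L2 d) :
    ((𝓕 (fourierMul φ u) : L2 d) : Space d → ℂ) =ᵐ[volume]
      fun ξ => (φ ξ : ℂ) * (𝓕 u : L2 d) ξ :=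
  fourier_ofFourier (memLp_mul_fourier φ u)

theorem norm_fourierMul_le {φ : BoundedContinuousFunction (Space d) ℝ} {C : ℝ} (hC : 0 ≤ C)
    (hφ : ∀ ξ, |φ ξ| ≤ C) : ‖fourierMul φ‖ ≤ C :=
  ContinuousLinearMap.opNorm_le_bound _ hC fun _ => norm_ofFourier_le _ hφ

theorem fourierMul_mul (φ ψ : BoundedContinuousFunction (Space d) ℝ) :
    fourierMul φ * fourierMul ψ = fourierMul (φ * ψ) := by
  ext1 u
  apply eq_of_fourier_ae_eq
  rw [mul_apply_eq_comp]
  filter_upwards [fourier_fourierMul φ (fourierMul ψ u), fourier_fourierMul ψ u,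
    fourier_fourierMul (φ * ψ) u] with ξ h1 h2 h3
  rw [h1, h2, h3, BoundedContinuousFunction.coe_mul, Pi.mul_apply, Complex.ofReal_mul, mul_assoc]

theorem fourierMul_add (φ ψ : BoundedContinuousFunction (Space d) ℝ) :
    fourierMul φ + fourierMul ψ = fourierMul (φ + ψ) := by
  ext1 u
  apply eq_of_fourier_ae_eq
  rw [add_apply, FourierTransform.fourier_add]
  filter_upwards [fourier_fourierMul φ u, fourier_fourierMul ψ u,
    fourier_fourierMul (φ + ψ) u, Lp.coeFn_add (𝓕 (fourierMul φ u) : L2 d)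
      (𝓕 (fourierMul ψ u) : L2 d)] with ξ h1 h2 h3 h4
  rw [h4, h3, Pi.add_apply, h1, h2, BoundedContinuousFunction.coe_add, Pi.add_apply,
    Complex.ofReal_add, add_mul]

theorem fourierMul_one : fourierMul (1 : BoundedContinuousFunction (Space d) ℝ) = 1 := by
  ext1 u
  apply eq_of_fourier_ae_eq
  filter_upwards [fourier_fourierMul 1 u] with ξ h1
  rw [h1, one_apply_eq_self]
  simp

theorem fourierMul_comm (φ ψ : BoundedContinuousFunction (Space d) ℝ) :
    Commute (fourierMul φ) (fourierMul ψ) := by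
  rw [Commute, SemiconjBy, fourierMul_mul, fourierMul_mul, mul_comm]

theorem inner_eq_integral_fourier (u v : L2 d) :
    inner ℂ u v = ∫ ξ, conj ((𝓕 u : L2 d) ξ) * (𝓕 v : L2 d) ξ := by
  rw [← Lp.inner_fourier_eq, L2.inner_def]
  refine integral_congr_ae (Eventually.of_forall fun ξ => ?_)
  simp only [RCLike.inner_apply]
  ring

theorem fourierMul_isSelfAdjoint (φ : BoundedContinuousFunction (Space d) ℝ) :
    IsSelfAdjoint (fourierMul φ) := by
  rw [ContinuousLinearMap.isSelfAdjoint_iff_isSymmetric]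
  intro u v
  change inner ℂ (fourierMul φ u) v = inner ℂ u (fourierMul φ v)
  rw [inner_eq_integral_fourier, inner_eq_integral_fourier]
  refine integral_congr_ae ?_
  filter_upwards [fourier_fourierMul φ u, fourier_fourierMul φ v] with ξ h1 h2
  rw [h1, h2, map_mul, Complex.conj_ofReal]
  ring

theorem fourierMul_injective {φ : BoundedContinuousFunction (Space d) ℝ} (hφ : ∀ ξ, φ ξ ≠ 0)
    {u : L2 d} (h : fourierMul φ u = 0) : u = 0 := by
  apply eq_of_fourier_ae_eq
  have h1 := fourier_fourierMul φ u
  rw [h, FourierTransform.fourier_zero] at h1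
  rw [FourierTransform.fourier_zero]
  filter_upwards [h1, Lp.coeFn_zero ℂ 2 (volume : Measure (Space d))] with ξ a1 a2
  rw [a2, Pi.zero_apply] at a1 ⊢
  have : (φ ξ : ℂ) ≠ 0 := by exact_mod_cast hφ ξ
  exact (mul_eq_zero.1 a1.symm).resolve_left this

theorem norm_sq_fourierMul (φ : BoundedContinuousFunction (Space d) ℝ) (u : L2 d) :
    ‖fourierMul φ u‖ ^ 2 = ∫ ξ, φ ξ ^ 2 * ‖(𝓕 u : L2 d) ξ‖ ^ 2 := by
  rw [← Lp.norm_fourier_eq, norm_sq_eq_integral_norm_sq]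
  refine integral_congr_ae ?_
  filter_upwards [fourier_fourierMul φ u] with ξ h
  rw [h, norm_mul, Complex.norm_real, mul_pow, Real.norm_eq_abs, sq_abs]

theorem integrable_sq_mul_fourier (φ : BoundedContinuousFunction (Space d) ℝ) (u : L2 d) :
    Integrable (fun ξ => φ ξ ^ 2 * ‖(𝓕 u : L2 d) ξ‖ ^ 2) := by
  refine (integrable_norm_sq (𝓕 (fourierMul φ u) : L2 d)).congr ?_
  filter_upwards [fourier_fourierMul φ u] with ξ h
  rw [h, norm_mul, Complex.norm_real, mul_pow, Real.norm_eq_abs, sq_abs]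

/-- By Plancherel a quadratic inequality between multipliers reduces to a pointwise one for their
symbols; every operator bound drawn from the form bound goes through this. -/
theorem norm_sq_fourierMul_add_le {φ ψ : BoundedContinuousFunction (Space d) ℝ} {β C : ℝ}
    (h : ∀ ξ, φ ξ ^ 2 + β * ψ ξ ^ 2 ≤ C) (u : L2 d) :
    ‖fourierMul φ u‖ ^ 2 + β * ‖fourierMul ψ u‖ ^ 2 ≤ C * ‖u‖ ^ 2 := by
  rw [norm_sq_fourierMul, norm_sq_fourierMul, ← Lp.norm_fourier_eq u,
    norm_sq_eq_integral_norm_sq (𝓕 u : L2 d), ← integral_const_mul, ← integral_const_mul,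
    ← integral_add (integrable_sq_mul_fourier φ u) ((integrable_sq_mul_fourier ψ u).const_mul β)]
  refine integral_mono ((integrable_sq_mul_fourier φ u).add
    ((integrable_sq_mul_fourier ψ u).const_mul β))
    ((integrable_norm_sq (𝓕 u : L2 d)).const_mul C) fun ξ => ?_
  simp only
  nlinarith [h ξ, sq_nonneg ‖(𝓕 u : L2 d) ξ‖]

end Multipliers

/-! ### Test functions in the Sobolev space of order one -/

section TestFunctions

variable {d : ℕ}

theorem hasTemperateGrowth_sobolevWeight (s : ℝ) :
    (sobolevWeight (d := d) s).HasTemperateGrowth := by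
  have h := (Function.hasTemperateGrowth_one_add_norm_sq_rpow (Space d) (s / 2)).comp
    ((2 * Real.pi) • ContinuousLinearMap.id ℝ (Space d)).hasTemperateGrowth
  have e : sobolevWeight (d := d) s = (fun x : Space d => (1 + ‖x‖ ^ 2) ^ (s / 2)) ∘
      ((2 * Real.pi) • ContinuousLinearMap.id ℝ (Space d)) := by
    funext ξ
    simp [sobolevWeight, norm_smul, abs_of_pos Real.pi_pos]
  rw [e]
  exact h

theorem hasTemperateGrowth_ofReal_sobolevWeight (s : ℝ) :
    (fun ξ : Space d => (sobolevWeight s ξ : ℂ)).HasTemperateGrowth :=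
  Function.Complex.hasTemperateGrowth_ofReal.comp (hasTemperateGrowth_sobolevWeight s)

/-- The Bessel potential `(1 - Δ)^(s/2)` on Schwartz functions. -/
def besselSchwartz (s : ℝ) : SchwartzMap (Space d) ℂ →L[ℂ] SchwartzMap (Space d) ℂ :=
  SchwartzMap.fourierMultiplierCLM ℂ fun ξ => (sobolevWeight s ξ : ℂ)

theorem sobolevWeight_mul_neg (s : ℝ) (ξ : Space d) :
    sobolevWeight s ξ * sobolevWeight (-s) ξ = 1 := by
  unfold sobolevWeight
  rw [← Real.rpow_add (by positivity)]
  simp [neg_div]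

theorem sobolevWeight_one_sq (ξ : Space d) :
    sobolevWeight 1 ξ ^ 2 = 1 + (2 * Real.pi * ‖ξ‖) ^ 2 := by
  unfold sobolevWeight
  rw [← Real.rpow_natCast, ← Real.rpow_mul (by positivity)]
  norm_num

/-- It makes `(1 - Δ)^(s/2)` surjective on Schwartz functions, as the density argument requires. -/
theorem besselSchwartz_besselSchwartz_neg (s : ℝ) (g : SchwartzMap (Space d) ℂ) :
    besselSchwartz s (besselSchwartz (-s) g) = g := by
  unfold besselSchwartz
  rw [SchwartzMap.fourierMultiplierCLM_fourierMultiplierCLM_apply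
    (hasTemperateGrowth_ofReal_sobolevWeight _) (hasTemperateGrowth_ofReal_sobolevWeight _)]
  have : ((fun ξ : Space d => (sobolevWeight s ξ : ℂ)) * fun ξ => (sobolevWeight (-s) ξ : ℂ)) =
      fun _ => 1 := by
    ext ξ
    rw [Pi.mul_apply, ← Complex.ofReal_mul, sobolevWeight_mul_neg, Complex.ofReal_one]
  rw [this, SchwartzMap.fourierMultiplierCLM_const]
  simp

theorem fourier_toLp_ae (g : SchwartzMap (Space d) ℂ) :
    ((𝓕 (g.toLp 2 volume) : L2 d) : Space d → ℂ) =ᵐ[volume]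
      (𝓕 g : SchwartzMap (Space d) ℂ) := by
  rw [SchwartzMap.toLp_fourier_eq]
  exact SchwartzMap.coeFn_toLp _ _ _

theorem fourier_besselSchwartz_apply (s : ℝ) (g : SchwartzMap (Space d) ℂ) (ξ : Space d) :
    𝓕 (besselSchwartz s g) ξ = sobolevWeight s ξ * 𝓕 g ξ := by
  rw [besselSchwartz, SchwartzMap.fourierMultiplierCLM_apply,
    FourierTransform.fourier_fourierInv_eq,
    SchwartzMap.smulLeftCLM_apply_apply (hasTemperateGrowth_ofReal_sobolevWeight s), smul_eq_mul]

/-- The squared length of the gradient. -/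
def gradSq (f : Space d → ℂ) (x : Space d) : ℝ :=
  ∑ i, ‖fderiv ℝ f x (EuclideanSpace.single i 1)‖ ^ 2

open LineDeriv in
theorem integrable_gradSq_summand (g : SchwartzMap (Space d) ℂ) (i : Fin d) :
    Integrable fun x => ‖fderiv ℝ g x (EuclideanSpace.single i 1)‖ ^ 2 := by
  have h := (∂_{(EuclideanSpace.single i 1 : Space d)} g).memLp 2 volume
  simpa only [SchwartzMap.lineDerivOp_apply_eq_fderiv] using
    (memLp_two_iff_integrable_sq_norm h.1).1 h

theorem integrable_gradSq (g : SchwartzMap (Space d) ℂ) : Integrable (gradSq g) :=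
  integrable_finsetSum _ fun i _ => integrable_gradSq_summand g i

theorem integrable_norm_sq_schwartz (g : SchwartzMap (Space d) ℂ) :
    Integrable fun x => ‖g x‖ ^ 2 :=
  (memLp_two_iff_integrable_sq_norm g.continuous.aestronglyMeasurable).1 (g.memLp 2)

open LineDeriv in
/-- Plancherel's theorem for the gradient. -/
theorem integral_gradSq (g : SchwartzMap (Space d) ℂ) :
    ∫ x, gradSq g x = ∫ ξ, (2 * Real.pi * ‖ξ‖) ^ 2 * ‖𝓕 g ξ‖ ^ 2 := by
  have h (i : Fin d) (ξ : Space d) :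
      ‖𝓕 (∂_{(EuclideanSpace.single i 1 : Space d)} g) ξ‖ ^ 2 =
        (2 * Real.pi) ^ 2 * ξ i ^ 2 * ‖𝓕 g ξ‖ ^ 2 := by
    rw [SchwartzMap.fourier_lineDerivOp_eq, smul_apply,
      SchwartzMap.smulLeftCLM_apply_apply (by fun_prop)]
    simp [EuclideanSpace.inner_single_right, mul_pow, abs_of_pos Real.pi_pos]
    ring
  have hint (i : Fin d) : Integrable fun ξ =>
      ‖𝓕 (∂_{(EuclideanSpace.single i 1 : Space d)} g) ξ‖ ^ 2 := integrable_norm_sq_schwartz _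
  unfold gradSq
  rw [integral_finsetSum _ fun i _ => integrable_gradSq_summand g i]
  calc ∑ i, ∫ x, ‖fderiv ℝ g x (EuclideanSpace.single i 1)‖ ^ 2
      = ∑ i, ∫ ξ, ‖𝓕 (∂_{(EuclideanSpace.single i 1 : Space d)} g) ξ‖ ^ 2 := by
        refine Finset.sum_congr rfl fun i _ => ?_
        rw [SchwartzMap.integral_norm_sq_fourier]
        rfl
    _ = ∫ ξ, ∑ i, ‖𝓕 (∂_{(EuclideanSpace.single i 1 : Space d)} g) ξ‖ ^ 2 :=
        (integral_finsetSum _ fun i _ => hint i).symm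
    _ = _ := by
        refine integral_congr_ae (Eventually.of_forall fun ξ => ?_)
        simp only [h, ← Finset.sum_mul, ← Finset.mul_sum]
        rw [mul_pow (2 * Real.pi) ‖ξ‖, EuclideanSpace.norm_sq_eq ξ]
        simp only [Real.norm_eq_abs, sq_abs]

theorem integrable_sq_mul_fourier_schwartz (g : SchwartzMap (Space d) ℂ) :
    Integrable fun ξ => (2 * Real.pi * ‖ξ‖) ^ 2 * ‖𝓕 g ξ‖ ^ 2 := by
  refine (integrable_norm_sq_schwartz (𝓕 (besselSchwartz 1 g))).mono'
    (Continuous.aestronglyMeasurable (by have := (𝓕 g).continuous; fun_prop))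
    (Eventually.of_forall fun ξ => ?_)
  rw [Real.norm_of_nonneg (by positivity), fourier_besselSchwartz_apply, norm_mul,
    mul_pow ‖_‖ ‖_‖, Complex.norm_real, Real.norm_eq_abs, sq_abs, sobolevWeight_one_sq]
  nlinarith [sq_nonneg ‖𝓕 g ξ‖]

theorem norm_sq_toLp_schwartz (g : SchwartzMap (Space d) ℂ) :
    ‖g.toLp 2 volume‖ ^ 2 = ∫ x, ‖g x‖ ^ 2 := by
  rw [norm_sq_eq_integral_norm_sq]
  refine integral_congr_ae ?_
  filter_upwards [SchwartzMap.coeFn_toLp g 2 volume] with x hx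
  rw [hx]

/-- Writing the `H¹` norm on the position side allows truncation errors to be treated by dominated
convergence. -/
theorem norm_sq_toLp_besselSchwartz (g : SchwartzMap (Space d) ℂ) :
    ‖(besselSchwartz 1 g).toLp 2 volume‖ ^ 2 = ∫ x, ‖g x‖ ^ 2 + gradSq g x := by
  rw [integral_add (integrable_norm_sq_schwartz g) (integrable_gradSq g), integral_gradSq,
    ← SchwartzMap.integral_norm_sq_fourier, ← integral_add (integrable_norm_sq_schwartz (𝓕 g))
    (integrable_sq_mul_fourier_schwartz g), norm_sq_toLp_schwartz,
    ← SchwartzMap.integral_norm_sq_fourier]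
  refine integral_congr_ae (Eventually.of_forall fun ξ => ?_)
  simp only
  rw [fourier_besselSchwartz_apply, norm_mul, mul_pow, Complex.norm_real, Real.norm_eq_abs,
    sq_abs, sobolevWeight_one_sq]
  ring

/-! ### Density of test functions by truncation -/

/-- A test function as a Schwartz function. -/
def testToSchwartz : Test d →ₗ[ℂ] SchwartzMap (Space d) ℂ where
  toFun f := f.hasCompactSupport.toSchwartzMap f.contDiff
  map_add' f g := by ext x; rfl
  map_smul' c f := by ext x; rfl

theorem coe_testToSchwartz (f : Test d) : ⇑(testToSchwartz f) = f := rfl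

/-- The map `f ↦ (1 - Δ)^(1/2) f` from test functions to `L²`. -/
def besselTest : Test d →ₗ[ℂ] L2 d :=
  ((SchwartzMap.toLpCLM ℂ ℂ 2 volume).comp (besselSchwartz 1)).toLinearMap.comp testToSchwartz

theorem besselTest_apply (f : Test d) :
    besselTest f = (besselSchwartz 1 (testToSchwartz f)).toLp 2 volume := rfl

/-- A smooth cutoff function. -/
def cutoff : ContDiffBump (0 : Space d) := ⟨1, 2, one_pos, one_lt_two⟩

theorem exists_fderiv_cutoff_le :
    ∃ C : ℝ, ∀ x : Space d, ‖fderiv ℝ (cutoff : Space d → ℝ) x‖ ≤ C := by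
  have h1 : Continuous (fderiv ℝ (cutoff : Space d → ℝ)) :=
    (cutoff.contDiff (n := 1)).continuous_fderiv one_ne_zero
  obtain ⟨C, hC⟩ := h1.bounded_above_of_compact_support (cutoff.hasCompactSupport.fderiv (𝕜 := ℝ))
  exact ⟨C, hC⟩

/-- The product of a Schwartz function with the cutoff function at scale `n + 1`. -/
def truncate (g : SchwartzMap (Space d) ℂ) (n : ℕ) : Test d where
  toFun x := cutoff ((n + 1 : ℝ)⁻¹ • x) • g x
  contDiff' := by
    have h1 : ContDiff ℝ ((⊤ : ℕ∞) : WithTop ℕ∞) fun x : Space d =>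
        cutoff ((n + 1 : ℝ)⁻¹ • x) :=
      (cutoff (d := d)).contDiff.comp (contDiff_const_smul (n + 1 : ℝ)⁻¹)
    exact h1.smul (g.smooth ⊤)
  hasCompactSupport' := by
    have h0 : (n + 1 : ℝ)⁻¹ ≠ 0 := by positivity
    have h1 : HasCompactSupport fun x : Space d => cutoff ((n + 1 : ℝ)⁻¹ • x) :=
      (cutoff (d := d)).hasCompactSupport.comp_smul h0
    exact h1.smul_right
  tsupport_subset' := fun _ _ => trivial

theorem truncate_sub_apply (g : SchwartzMap (Space d) ℂ) (n : ℕ) (x : Space d) :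
    (testToSchwartz (truncate g n) - g) x = (cutoff ((n + 1 : ℝ)⁻¹ • x) - 1) • g x := by
  rw [sub_smul, one_smul]
  rfl

theorem norm_cutoff_sub_one_le (x : Space d) : ‖cutoff x - 1‖ ≤ 1 := by
  rw [Real.norm_eq_abs, abs_le]
  constructor <;> linarith [cutoff.nonneg (x := x), cutoff.le_one (x := x)]

/-- Vanishing in a neighbourhood, and not merely at `x`, also kills the derivative there. -/
theorem truncate_sub_eventuallyEq (g : SchwartzMap (Space d) ℂ) {n : ℕ} {x : Space d}
    (hx : ‖x‖ < n + 1) : ⇑(testToSchwartz (truncate g n) - g) =ᶠ[𝓝 x] 0 := by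
  have ho : IsOpen {y : Space d | ‖y‖ < n + 1} := isOpen_lt continuous_norm continuous_const
  filter_upwards [ho.mem_nhds hx] with y (hy : ‖y‖ < n + 1)
  have h1 : cutoff ((n + 1 : ℝ)⁻¹ • y) = 1 := by
    apply cutoff.one_of_mem_closedBall
    rw [mem_closedBall_zero_iff, norm_smul, Real.norm_of_nonneg (by positivity),
      inv_mul_le_iff₀ (by positivity)]
    simpa [cutoff] using hy.le
  rw [truncate_sub_apply, h1, sub_self, zero_smul, Pi.zero_apply]

/-- The product rule gives a bound uniform in `n`, because rescaling multiplies the gradient of the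
cutoff by `(n + 1)⁻¹ ≤ 1`. -/
theorem norm_fderiv_truncate_sub_le {C : ℝ}
    (hC : ∀ x : Space d, ‖fderiv ℝ (cutoff : Space d → ℝ) x‖ ≤ C)
    (g : SchwartzMap (Space d) ℂ) (n : ℕ) (x v : Space d) (hv : ‖v‖ = 1) :
    ‖fderiv ℝ (testToSchwartz (truncate g n) - g) x v‖ ≤ ‖fderiv ℝ g x v‖ + C * ‖g x‖ := by
  have e : ⇑(testToSchwartz (truncate g n) - g) =
      fun x => (cutoff ((n + 1 : ℝ)⁻¹ • x) - 1) • g x := funext (truncate_sub_apply g n)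
  have hd : HasFDerivAt (fun x : Space d => cutoff ((n + 1 : ℝ)⁻¹ • x) - 1)
      ((n + 1 : ℝ)⁻¹ • fderiv ℝ (cutoff : Space d → ℝ) ((n + 1 : ℝ)⁻¹ • x)) x := by
    have h1 : HasFDerivAt (cutoff : Space d → ℝ) _ ((n + 1 : ℝ)⁻¹ • x) :=
      ((cutoff.contDiff (n := 1)).differentiable one_ne_zero _).hasFDerivAt
    have h2 := (h1.comp x ((hasFDerivAt_id x).const_smul (n + 1 : ℝ)⁻¹)).sub_const 1
    refine h2.congr_fderiv ?_
    rw [ContinuousLinearMap.comp_smul, ContinuousLinearMap.comp_id]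
  rw [e, (hd.fun_smul g.differentiableAt.hasFDerivAt).fderiv]
  simp only [add_apply, smul_apply, ContinuousLinearMap.smulRight_apply]
  refine (norm_add_le _ _).trans (add_le_add ?_ ?_)
  · rw [norm_smul]
    exact mul_le_of_le_one_left (norm_nonneg _) (norm_cutoff_sub_one_le _)
  · rw [norm_smul]
    refine mul_le_mul_of_nonneg_right ?_ (norm_nonneg _)
    rw [norm_smul, Real.norm_of_nonneg (by positivity)]
    have h3 : ‖fderiv ℝ (cutoff : Space d → ℝ) ((n + 1 : ℝ)⁻¹ • x) v‖ ≤ C := by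
      refine (ContinuousLinearMap.le_opNorm _ _).trans ?_
      rw [hv, mul_one]
      exact hC _
    refine (mul_le_of_le_one_left (norm_nonneg _) (inv_le_one_of_one_le₀ ?_)).trans h3
    linarith [n.cast_nonneg (α := ℝ)]

theorem tendsto_besselTest_truncate (g : SchwartzMap (Space d) ℂ) :
    Tendsto (fun n => besselTest (truncate g n)) atTop
      (𝓝 ((besselSchwartz 1 g).toLp 2 volume)) := by
  obtain ⟨C, hC⟩ := exists_fderiv_cutoff_le (d := d)
  have hnorm (n : ℕ) : ‖besselTest (truncate g n) - (besselSchwartz 1 g).toLp 2 volume‖ ^ 2 =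
      ∫ x, ‖(testToSchwartz (truncate g n) - g) x‖ ^ 2 +
        gradSq (testToSchwartz (truncate g n) - g) x := by
    rw [← norm_sq_toLp_besselSchwartz, besselTest_apply, map_sub]
    congr 2
  have hlim : Tendsto (fun n : ℕ => ∫ x, ‖(testToSchwartz (truncate g n) - g) x‖ ^ 2 +
        gradSq (testToSchwartz (truncate g n) - g) x) atTop (𝓝 (∫ _ : Space d, (0 : ℝ))) := by
    -- At each point the integrand is eventually zero. The majorant comes from the uniform
    -- derivative bound and `(a + b)² ≤ 2a² + 2b²`.
    refine tendsto_integral_of_dominated_convergence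
      (fun x => ‖g x‖ ^ 2 + ∑ i, (2 * ‖fderiv ℝ g x (EuclideanSpace.single i 1)‖ ^ 2 +
        2 * C ^ 2 * ‖g x‖ ^ 2)) ?_ ?_ ?_ ?_
    · intro n
      exact ((integrable_norm_sq_schwartz _).add (integrable_gradSq _)).aestronglyMeasurable
    · exact (integrable_norm_sq_schwartz g).add (integrable_finsetSum _ fun i _ =>
        ((integrable_gradSq_summand g i).const_mul 2).add
          ((integrable_norm_sq_schwartz g).const_mul _))
    · intro n
      refine Eventually.of_forall fun x => ?_
      rw [Real.norm_of_nonneg (by unfold gradSq; positivity)]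
      refine add_le_add ?_ (Finset.sum_le_sum fun i _ => ?_)
      · rw [truncate_sub_apply, norm_smul]
        exact pow_le_pow_left₀ (by positivity)
          (mul_le_of_le_one_left (norm_nonneg _) (norm_cutoff_sub_one_le _)) 2
      · have h := norm_fderiv_truncate_sub_le hC g n x (EuclideanSpace.single i 1) (by simp)
        refine (pow_le_pow_left₀ (norm_nonneg _) h 2).trans ?_
        nlinarith [sq_nonneg (‖fderiv ℝ g x (EuclideanSpace.single i 1)‖ - C * ‖g x‖)]
    · refine Eventually.of_forall fun x => ?_
      refine tendsto_const_nhds.congr' ?_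
      filter_upwards [(tendsto_natCast_atTop_atTop (R := ℝ)).eventually_gt_atTop ‖x‖] with n hn
      have h := truncate_sub_eventuallyEq g (n := n) (x := x) (by linarith)
      rw [h.eq_of_nhds, gradSq, h.fderiv_eq]
      simp
  rw [tendsto_iff_norm_sub_tendsto_zero]
  rw [integral_zero] at hlim
  have h2 := (hlim.congr fun n => (hnorm n).symm).sqrt
  simpa only [Real.sqrt_sq (norm_nonneg _), Real.sqrt_zero] using h2

/-- Test functions are dense in the Sobolev space of order one. -/
theorem denseRange_besselTest : DenseRange (besselTest (d := d)) := by
  have h1 : DenseRange (SchwartzMap.toLpCLM ℝ ℂ 2 (volume : Measure (Space d))) :=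
    SchwartzMap.denseRange_toLpCLM (by simp)
  rw [DenseRange, ← dense_closure]
  refine h1.mono ?_
  rintro _ ⟨h, rfl⟩
  -- Every Schwartz `h` is `(1 - Δ)^(1/2) g` with `g = (1 - Δ)^(-1/2) h` Schwartz, and truncating
  -- `g` approximates `h`.
  have H := mem_closure_of_tendsto (tendsto_besselTest_truncate (besselSchwartz (-1) h))
    (Eventually.of_forall fun n => Set.mem_range_self _)
  rwa [besselSchwartz_besselSchwartz_neg] at H

end TestFunctions

/-! ### Existence and bounds of the trace map -/

section Trace

variable {d : ℕ}

/-- The symbol `(1 + p²)^(-1/2)`. -/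
def invWeight : BoundedContinuousFunction (Space d) ℝ :=
  BoundedContinuousFunction.ofNormedAddCommGroup (sobolevWeight (-1))
    (continuous_sobolevWeight _) 1 fun ξ => by
      rw [Real.norm_of_nonneg (sobolevWeight_pos _ _).le]
      exact Real.rpow_le_one_of_one_le_of_nonpos (by nlinarith [sq_nonneg (2 * Real.pi * ‖ξ‖)])
        (by norm_num)

theorem invWeight_sq (ξ : Space d) : invWeight ξ ^ 2 * (1 + (2 * Real.pi * ‖ξ‖) ^ 2) = 1 := by
  rw [← sobolevWeight_one_sq, ← mul_pow, mul_comm]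
  change (sobolevWeight 1 ξ * sobolevWeight (-1) ξ) ^ 2 = 1
  rw [sobolevWeight_mul_neg, one_pow]

theorem sobolevWeight_mul_invWeight (ξ : Space d) : sobolevWeight 1 ξ * invWeight ξ = 1 :=
  sobolevWeight_mul_neg 1 ξ

/-- The symbol `|p| (1 + p²)^(-1/2)`. -/
def gradWeight : BoundedContinuousFunction (Space d) ℝ :=
  BoundedContinuousFunction.ofNormedAddCommGroup
    (fun ξ => 2 * Real.pi * ‖ξ‖ * invWeight ξ)
    (by have := (invWeight (d := d)).continuous; fun_prop) 1 fun ξ => by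
      rw [Real.norm_eq_abs, ← sq_le_one_iff_abs_le_one, mul_pow]
      nlinarith [invWeight_sq ξ, sq_nonneg (invWeight ξ)]

theorem gradWeight_apply (ξ : Space d) : gradWeight ξ = 2 * Real.pi * ‖ξ‖ * invWeight ξ := rfl

theorem gradWeight_sq_add (ξ : Space d) : gradWeight ξ ^ 2 + invWeight ξ ^ 2 = 1 := by
  rw [gradWeight_apply, ← invWeight_sq ξ]
  ring

/-- The isometry `(1 - Δ)^(1/2)` from the Sobolev space of order one to `L²`. -/
def besselMap : sobolev d 1 →ₗ[ℂ] L2 d where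
  toFun u := ofFourier (memLp_of_mem_sobolev u.2)
  map_add' u v := by
    apply eq_of_fourier_ae_eq
    filter_upwards [fourier_ofFourier (memLp_of_mem_sobolev (u + v).2),
      fourier_ofFourier (memLp_of_mem_sobolev u.2), fourier_ofFourier (memLp_of_mem_sobolev v.2),
      fourier_add_ae (u : L2 d) v, fourier_add_ae (ofFourier (memLp_of_mem_sobolev u.2))
        (ofFourier (memLp_of_mem_sobolev v.2))] with ξ a1 a2 a3 a4 a5
    rw [a1, a5, a2, a3, Submodule.coe_add, a4, mul_add]
  map_smul' c u := by
    apply eq_of_fourier_ae_eq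
    rw [RingHom.id_apply]
    filter_upwards [fourier_ofFourier (memLp_of_mem_sobolev (c • u).2),
      fourier_ofFourier (memLp_of_mem_sobolev u.2), fourier_smul_ae c (u : L2 d),
      fourier_smul_ae c (ofFourier (memLp_of_mem_sobolev u.2))] with ξ a1 a2 a3 a4
    rw [a1, a4, a2, Submodule.coe_smul, a3]
    ring

theorem fourier_besselMap (u : sobolev d 1) :
    ((𝓕 (besselMap u) : L2 d) : Space d → ℂ) =ᵐ[volume]
      fun ξ => (sobolevWeight 1 ξ : ℂ) * (𝓕 (u : L2 d) : L2 d) ξ :=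
  fourier_ofFourier (memLp_of_mem_sobolev u.2)

theorem norm_besselMap (u : sobolev d 1) :
    ‖besselMap u‖ = (sobolevENorm 1 (u : L2 d)).toReal := by
  rw [← Lp.norm_fourier_eq, Lp.norm_def, sobolevENorm, eLpNorm_congr_ae (fourier_besselMap u)]

theorem fourierMul_invWeight_besselMap (u : sobolev d 1) :
    fourierMul invWeight (besselMap u) = u := by
  apply eq_of_fourier_ae_eq
  filter_upwards [fourier_fourierMul invWeight (besselMap u), fourier_besselMap u] with ξ h1 h2
  rw [h1, h2, ← mul_assoc, ← Complex.ofReal_mul, mul_comm (invWeight ξ),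
    sobolevWeight_mul_invWeight, Complex.ofReal_one, one_mul]

theorem sobolevWeight_mul_fourier_invWeight (a : L2 d) :
    (fun ξ => (sobolevWeight 1 ξ : ℂ) * (𝓕 (fourierMul invWeight a) : L2 d) ξ) =ᵐ[volume]
      (𝓕 a : L2 d) := by
  filter_upwards [fourier_fourierMul invWeight a] with ξ h1
  rw [h1, ← mul_assoc, ← Complex.ofReal_mul, sobolevWeight_mul_invWeight, Complex.ofReal_one,
    one_mul]

theorem fourierMul_invWeight_mem (a : L2 d) : fourierMul invWeight a ∈ sobolev d 1 :=
  lt_of_le_of_lt (eLpNorm_congr_ae (sobolevWeight_mul_fourier_invWeight a)).le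
    (Lp.eLpNorm_lt_top _)

theorem besselMap_fourierMul_invWeight (a : L2 d) :
    besselMap ⟨fourierMul invWeight a, fourierMul_invWeight_mem a⟩ = a := by
  apply eq_of_fourier_ae_eq
  exact (fourier_besselMap _).trans (sobolevWeight_mul_fourier_invWeight a)

/-- The map `(1 - Δ)^(-1/2)` from `L²` to the Sobolev space of order one. -/
def besselInv : L2 d →ₗ[ℂ] sobolev d 1 :=
  (fourierMul invWeight).toLinearMap.codRestrict _ fourierMul_invWeight_mem

theorem besselMap_besselInv (a : L2 d) : besselMap (besselInv a) = a :=
  besselMap_fourierMul_invWeight a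

theorem besselInv_besselMap (u : sobolev d 1) : besselInv (besselMap u) = u :=
  Subtype.ext (fourierMul_invWeight_besselMap u)

/-! ### The form bound after applying `(1 - Δ)^(1/2)`, and the trace map -/

theorem toLp_testToSchwartz (f : Test d) :
    (testToSchwartz f).toLp 2 volume = (memLp_test f volume).toLp (f : Space d → ℂ) := rfl

theorem fourier_besselTest (f : Test d) :
    ((𝓕 (besselTest f) : L2 d) : Space d → ℂ) =ᵐ[volume]
      fun ξ => (sobolevWeight 1 ξ : ℂ) * (𝓕 (testToSchwartz f) : SchwartzMap (Space d) ℂ) ξ := by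
  filter_upwards [fourier_toLp_ae (besselSchwartz 1 (testToSchwartz f))] with ξ h
  rw [besselTest_apply, h, fourier_besselSchwartz_apply]

theorem besselMap_test (f : Test d)
    (hf : (memLp_test f volume).toLp (f : Space d → ℂ) ∈ sobolev d 1) :
    besselMap ⟨_, hf⟩ = besselTest f := by
  apply eq_of_fourier_ae_eq
  filter_upwards [fourier_besselMap ⟨_, hf⟩, fourier_besselTest f,
    fourier_toLp_ae (testToSchwartz f)] with ξ h1 h2 h3
  rw [h1, h2, ← toLp_testToSchwartz, h3]

theorem norm_sq_invWeight_besselTest (f : Test d) :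
    ‖fourierMul invWeight (besselTest f)‖ ^ 2 = ∫ x, ‖f x‖ ^ 2 := by
  rw [norm_sq_fourierMul, ← coe_testToSchwartz, ← SchwartzMap.integral_norm_sq_fourier]
  refine integral_congr_ae ?_
  filter_upwards [fourier_besselTest f] with ξ h
  rw [h, norm_mul, mul_pow, Complex.norm_real, Real.norm_eq_abs, sq_abs, sobolevWeight_one_sq]
  linear_combination ‖(𝓕 (testToSchwartz f) : SchwartzMap (Space d) ℂ) ξ‖ ^ 2 * invWeight_sq ξ

theorem norm_sq_gradWeight_besselTest (f : Test d) :
    ‖fourierMul gradWeight (besselTest f)‖ ^ 2 = ∫ x, gradSq f x := by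
  rw [norm_sq_fourierMul, ← coe_testToSchwartz, integral_gradSq]
  refine integral_congr_ae ?_
  filter_upwards [fourier_besselTest f] with ξ h
  rw [h, norm_mul, mul_pow ‖_‖ ‖_‖, Complex.norm_real, Real.norm_eq_abs, sq_abs,
    sobolevWeight_one_sq, gradWeight_apply]
  linear_combination (2 * Real.pi * ‖ξ‖) ^ 2 *
    ‖(𝓕 (testToSchwartz f) : SchwartzMap (Space d) ℂ) ξ‖ ^ 2 * invWeight_sq ξ

/-- A test function as an element of `L²(|m|)`. -/
def testToLp (m : RealRadonMeasure d) : Test d →ₗ[ℂ] Lp ℂ 2 m.abs where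
  toFun f := (memLp_test f m.abs).toLp (f : Space d → ℂ)
  map_add' _ _ := rfl
  map_smul' _ _ := rfl

theorem norm_sq_testToLp (m : RealRadonMeasure d) (f : Test d) :
    ‖testToLp m f‖ ^ 2 = ∫ x, ‖f x‖ ^ 2 ∂m.abs := by
  rw [norm_sq_eq_integral_norm_sq]
  refine integral_congr_ae ?_
  filter_upwards [(memLp_test f m.abs).coeFn_toLp] with x hx
  exact congrArg (fun z : ℂ => ‖z‖ ^ 2) hx

theorem FormBound.norm_sq_testToLp_le {m : RealRadonMeasure d} {η β : ℝ} (h : FormBound m η β)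
    (f : Test d) : ‖testToLp m f‖ ^ 2 ≤ η * (‖fourierMul gradWeight (besselTest f)‖ ^ 2 +
      β * ‖fourierMul invWeight (besselTest f)‖ ^ 2) := by
  rw [norm_sq_testToLp, norm_sq_gradWeight_besselTest, norm_sq_invWeight_besselTest]
  exact h f

/-- Absolute values appear because no sign of `η` or `β` is known here; the constant only has to
make the extension by density possible. -/
theorem FormBound.norm_testToLp_le {m : RealRadonMeasure d} {η β : ℝ} (h : FormBound m η β)
    (f : Test d) : ‖testToLp m f‖ ≤ √(|η| * (1 + |β|)) * ‖besselTest f‖ := by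
  rw [← Real.sqrt_sq (norm_nonneg (testToLp m f)), ← Real.sqrt_sq (norm_nonneg (besselTest f)),
    ← Real.sqrt_mul (by positivity)]
  refine Real.sqrt_le_sqrt ((h.norm_sq_testToLp_le f).trans ?_)
  have h1 := norm_sq_fourierMul_add_le (φ := gradWeight) (ψ := invWeight) (β := |β|)
    (C := 1 + |β|) (fun ξ => by
      nlinarith [gradWeight_sq_add ξ, sq_nonneg (gradWeight ξ), sq_nonneg (invWeight ξ),
        abs_nonneg β, mul_nonneg (abs_nonneg β) (sq_nonneg (gradWeight ξ))]) (besselTest f)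
  set A := ‖fourierMul gradWeight (besselTest f)‖ ^ 2
  set B := ‖fourierMul invWeight (besselTest f)‖ ^ 2
  have hA : 0 ≤ A := sq_nonneg _
  have hB : 0 ≤ B := sq_nonneg _
  calc η * (A + β * B) ≤ |η * (A + β * B)| := le_abs_self _
    _ = |η| * |A + β * B| := abs_mul _ _
    _ ≤ |η| * (A + |β| * B) := by
        refine mul_le_mul_of_nonneg_left ((abs_add_le _ _).trans ?_) (abs_nonneg _)
        rw [abs_of_nonneg hA, abs_mul, abs_of_nonneg hB]
    _ ≤ |η| * ((1 + |β|) * ‖besselTest f‖ ^ 2) := mul_le_mul_of_nonneg_left h1 (abs_nonneg _)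
    _ = _ := by ring

theorem exists_isTraceMap {m : RealRadonMeasure d} {η β : ℝ} (h : FormBound m η β) :
    ∃ J, IsTraceMap m J := by
  have hC := h.norm_testToLp_le
  refine ⟨((testToLp m).extendOfNorm besselTest).toLinearMap.comp besselMap,
    ⟨√(|η| * (1 + |β|)), fun u => ?_⟩, fun f hf => ?_⟩
  · rw [← norm_besselMap]
    exact LinearMap.norm_extendOfNorm_apply_le denseRange_besselTest _ hC (besselMap u)
  · change (testToLp m).extendOfNorm besselTest (besselMap ⟨_, hf⟩) = _
    rw [besselMap_test, LinearMap.extendOfNorm_eq denseRange_besselTest ⟨_, hC⟩]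
    rfl

theorem isTraceMap_traceMap {m : RealRadonMeasure d} {η β : ℝ} (h : FormBound m η β) :
    IsTraceMap m (traceMap m) := by
  have h1 := exists_isTraceMap h
  rw [traceMap, dif_pos h1]
  exact h1.choose_spec

theorem toLp_test_mem_sobolev (f : Test d) :
    (memLp_test f volume).toLp (f : Space d → ℂ) ∈ sobolev d 1 := by
  have h : fourierMul invWeight (besselTest f) =
      (memLp_test f volume).toLp (f : Space d → ℂ) := by
    apply eq_of_fourier_ae_eq
    filter_upwards [fourier_fourierMul invWeight (besselTest f), fourier_besselTest f,
      fourier_toLp_ae (testToSchwartz f)] with ξ h1 h2 h3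
    rw [h1, h2, ← toLp_testToSchwartz, h3, ← mul_assoc, ← Complex.ofReal_mul,
      mul_comm (invWeight ξ), sobolevWeight_mul_invWeight, Complex.ofReal_one, one_mul]
  rw [← h]
  exact fourierMul_invWeight_mem _

/-- The trace map factors through `(1 - Δ)^(1/2)`, and the form bounds extend from test functions
to the Sobolev space. -/
theorem exists_traceMap_factor {m : RealRadonMeasure d} {η₀ β₀ : ℝ} (h₀ : FormBound m η₀ β₀) :
    ∃ T : L2 d →L[ℂ] Lp ℂ 2 m.abs, (∀ u, traceMap m u = T (besselMap u)) ∧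
      ∀ η β, FormBound m η β → ∀ a, ‖T a‖ ^ 2 ≤
        η * (‖fourierMul gradWeight a‖ ^ 2 + β * ‖fourierMul invWeight a‖ ^ 2) := by
  have hJ := isTraceMap_traceMap h₀
  obtain ⟨C, hC⟩ := hJ.1
  -- `T = J_m (1 - Δ)^(-1/2)`, bounded because `(1 - Δ)^(1/2)` is isometric from `H¹` to `L²`.
  let T : L2 d →L[ℂ] Lp ℂ 2 m.abs := ((traceMap m).comp besselInv).mkContinuous C fun a => by
    have := hC (besselInv a)
    rwa [← norm_besselMap, besselMap_besselInv] at this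
  have hT (u : sobolev d 1) : traceMap m u = T (besselMap u) := by
    change _ = traceMap m (besselInv (besselMap u))
    rw [besselInv_besselMap]
  refine ⟨T, hT, fun η β h a => ?_⟩
  refine denseRange_besselTest.induction_on (p := fun a => ‖T a‖ ^ 2 ≤
    η * (‖fourierMul gradWeight a‖ ^ 2 + β * ‖fourierMul invWeight a‖ ^ 2)) a ?_ fun f => ?_
  · exact isClosed_le (by fun_prop) (by fun_prop)
  · have h1 : T (besselTest f) = testToLp m f := by
      rw [← besselMap_test f (toLp_test_mem_sobolev f), ← hT]
      exact hJ.2 f _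
    rw [h1]
    exact h.norm_sq_testToLp_le f

/-! ### Properties of the form bound -/

theorem exists_test_ne_zero : ∃ f : Test d, 0 < ∫ x, ‖f x‖ ^ 2 := by
  let f : Test d :=
    { toFun := fun x => ((cutoff x : ℝ) : ℂ)
      contDiff' := Complex.ofRealCLM.contDiff.comp (cutoff (d := d)).contDiff
      hasCompactSupport' := (cutoff (d := d)).hasCompactSupport.comp_left Complex.ofReal_zero
      tsupport_subset' := fun _ _ => trivial }
  refine ⟨f, ?_⟩
  have hc : Continuous fun x => ‖f x‖ ^ 2 := by have := f.continuous; fun_prop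
  refine hc.integral_pos_of_hasCompactSupport_nonneg_nonzero ?_ (fun x => by positivity)
    (x := 0) ?_
  · exact f.hasCompactSupport.norm.comp_left (g := fun t : ℝ => t ^ 2) (by simp)
  · have h1 : f 0 = 1 := by
      change ((cutoff (0 : Space d) : ℝ) : ℂ) = 1
      rw [cutoff.one_of_mem_closedBall (by simp [cutoff]), Complex.ofReal_one]
    simp [h1]

theorem gradSq_nonneg (f : Space d → ℂ) (x : Space d) : 0 ≤ gradSq f x :=
  Finset.sum_nonneg fun _ _ => by positivity

/-- The constant `η` ranges over all reals, and a single test function with nonzero `L²` norm forces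
its sign. -/
theorem FormBound.nonneg {m : RealRadonMeasure d} {η β : ℝ} (h : FormBound m η β) (hβ : 0 < β) :
    0 ≤ η := by
  obtain ⟨f, hf⟩ := exists_test_ne_zero (d := d)
  have h1 : 0 ≤ η * ((∫ x, gradSq f x) + β * ∫ x, ‖f x‖ ^ 2) :=
    (integral_nonneg fun _ => by positivity).trans (h f)
  have h2 : 0 < (∫ x, gradSq f x) + β * ∫ x, ‖f x‖ ^ 2 :=
    add_pos_of_nonneg_of_pos (integral_nonneg fun x => gradSq_nonneg f x) (mul_pos hβ hf)
  exact nonneg_of_mul_nonneg_left h1 h2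

theorem FormBound.mono_right {m : RealRadonMeasure d} {η β β' : ℝ} (h : FormBound m η β)
    (hη : 0 ≤ η) (hβ : β ≤ β') : FormBound m η β' := fun f =>
  (h f).trans (mul_le_mul_of_nonneg_left (add_le_add_right (mul_le_mul_of_nonneg_right hβ
    (integral_nonneg fun _ => by positivity)) _) hη)

/-! ### The optimal form constant and its decay -/

/-- The optimal constant in the form bound with the given value of `β`. -/
def optimalBound (m : RealRadonMeasure d) (β : ℝ) : ℝ := sInf {η : ℝ | FormBound m η β}

theorem bddBelow_formBound (m : RealRadonMeasure d) {β : ℝ} (hβ : 0 < β) :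
    BddBelow {η : ℝ | FormBound m η β} :=
  ⟨0, fun _ h => FormBound.nonneg h hβ⟩

theorem formBound_optimalBound {m : RealRadonMeasure d} {η β : ℝ} (h : FormBound m η β)
    (hβ : 0 < β) : FormBound m (optimalBound m β) β := by
  -- The admissible constants form an intersection of closed conditions, one per test function, so
  -- the infimum is attained.
  have hcl : IsClosed {η : ℝ | FormBound m η β} := by
    simp only [FormBound, Set.ofPred_forall]
    exact isClosed_iInter fun f => isClosed_le continuous_const (by fun_prop)
  exact hcl.csInf_mem ⟨η, h⟩ (bddBelow_formBound m hβ)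

theorem optimalBound_le {m : RealRadonMeasure d} {η β : ℝ} (h : FormBound m η β) (hβ : 0 < β) :
    optimalBound m β ≤ η :=
  csInf_le (bddBelow_formBound m hβ) h

theorem tendsto_optimalBound {m : RealRadonMeasure d}
    (hm : ∀ η : ℝ, 0 < η → ∃ β : ℝ, FormBound m η β) :
    Tendsto (optimalBound m) atTop (𝓝 0) := by
  rw [Metric.tendsto_atTop]
  intro δ hδ
  obtain ⟨β, hβ⟩ := hm (δ / 2) (by positivity)
  refine ⟨max β 1, fun β' hβ' => ?_⟩
  have h1 : 0 < β' := one_pos.trans_le ((le_max_right _ _).trans hβ')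
  have h2 := hβ.mono_right (by positivity) ((le_max_left _ _).trans hβ')
  rw [Real.dist_0_eq_abs, abs_of_nonneg ((formBound_optimalBound h2 h1).nonneg h1)]
  linarith [optimalBound_le h2 h1]

end Trace

/-! ### The symbols -/

section Symbols

variable {d : ℕ}

theorem symbol_nonneg (ε : ℝ) (ξ : Space d) : 0 ≤ symbol ε ξ := by
  unfold symbol; positivity

theorem continuous_symbol (ε : ℝ) : Continuous (symbol (d := d) ε) := by
  unfold symbol; fun_prop

theorem symbol_eq (ε : ℝ) (ξ : Space d) :
    symbol ε ξ = symbol 0 ξ + ε ^ 2 * symbol 0 ξ ^ 2 := by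
  unfold symbol; ring

theorem symbol_zero (ξ : Space d) : symbol 0 ξ = (2 * Real.pi * ‖ξ‖) ^ 2 := by
  unfold symbol; ring

/-- The symbol `(p² + ε²p⁴ + α)^(1/2)`. -/
def rootSymbol (α ε : ℝ) (ξ : Space d) : ℝ := √(symbol ε ξ + α)

theorem continuous_rootSymbol (α ε : ℝ) : Continuous (rootSymbol (d := d) α ε) := by
  unfold rootSymbol
  have := continuous_symbol (d := d) ε
  fun_prop

theorem rootSymbol_pos {α : ℝ} (hα : 0 < α) (ε : ℝ) (ξ : Space d) : 0 < rootSymbol α ε ξ :=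
  Real.sqrt_pos.2 (by linarith [symbol_nonneg ε ξ])

theorem rootSymbol_sq {α : ℝ} (hα : 0 < α) (ε : ℝ) (ξ : Space d) :
    rootSymbol α ε ξ ^ 2 = symbol ε ξ + α :=
  Real.sq_sqrt (by linarith [symbol_nonneg ε ξ])

theorem le_sqrt_mul_of_sq_le {a b C : ℝ} (hb : 0 ≤ b) (hC : 0 ≤ C) (h : a ^ 2 ≤ C * b ^ 2) :
    a ≤ √C * b :=
  le_of_sq_le_sq (by rwa [mul_pow, Real.sq_sqrt hC]) (by positivity)

theorem sobolevWeight_two (ξ : Space d) : sobolevWeight 2 ξ = 1 + symbol 0 ξ := by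
  rw [symbol_zero]
  simp [sobolevWeight]

/-- Together with the reverse comparison below, this identifies the range of `(-Δ + ε²Δ² +
α)^(-1/2)` with the form domain. The constant may depend on `ε`, since only membership is deduced.
-/
theorem sobolevWeight_le_rootSymbol {α : ℝ} (hα : 0 < α) (ε : ℝ) : ∃ C : ℝ, ∀ ξ : Space d,
    sobolevWeight (if ε = 0 then 1 else 2) ξ ≤ C * rootSymbol α ε ξ := by
  split_ifs with h
  · refine ⟨√(1 + 1 / α), fun ξ => le_sqrt_mul_of_sq_le (rootSymbol_pos hα ε ξ).le
      (by positivity) ?_⟩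
    rw [rootSymbol_sq hα, sobolevWeight_one_sq, ← symbol_zero, h]
    have h1 : (1 + 1 / α) * (symbol 0 ξ + α) = symbol 0 ξ + α + symbol 0 ξ / α + 1 := by
      field_simp; ring
    have h2 := div_nonneg (symbol_nonneg 0 ξ) hα.le
    linarith
  · refine ⟨√(1 / α + 2 + 1 / ε ^ 2), fun ξ => le_sqrt_mul_of_sq_le (rootSymbol_pos hα ε ξ).le
      (by positivity) ?_⟩
    rw [rootSymbol_sq hα, sobolevWeight_two, symbol_eq ε]
    have h0 := symbol_nonneg 0 ξ
    set x := symbol 0 ξ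
    have h1 : (1 / α + 2 + 1 / ε ^ 2) * (x + ε ^ 2 * x ^ 2 + α) = 1 + x ^ 2 + 2 * x +
        ((x + ε ^ 2 * x ^ 2) / α + 2 * (ε ^ 2 * x ^ 2 + α) + (x + α) / ε ^ 2) := by
      field_simp; ring
    have h2 : 0 ≤ (x + ε ^ 2 * x ^ 2) / α + 2 * (ε ^ 2 * x ^ 2 + α) + (x + α) / ε ^ 2 := by
      positivity
    nlinarith

theorem rootSymbol_le_sobolevWeight {α : ℝ} (hα : 0 < α) (ε : ℝ) : ∃ C : ℝ, ∀ ξ : Space d,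
    rootSymbol α ε ξ ≤ C * sobolevWeight (if ε = 0 then 1 else 2) ξ := by
  refine ⟨√(1 + α + ε ^ 2), fun ξ => le_sqrt_mul_of_sq_le (sobolevWeight_pos _ ξ).le
      (by positivity) ?_⟩
  have h0 := symbol_nonneg 0 ξ
  rw [rootSymbol_sq hα]
  split_ifs with h
  · rw [sobolevWeight_one_sq, ← symbol_zero, h]
    nlinarith [mul_nonneg hα.le h0]
  · rw [sobolevWeight_two, symbol_eq ε]
    nlinarith [mul_nonneg hα.le h0, mul_nonneg hα.le (sq_nonneg (symbol 0 ξ)), sq_nonneg ε,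
      mul_nonneg (sq_nonneg ε) h0, sq_nonneg (symbol 0 ξ)]

/-! ### Multipliers comparing the free operators -/

variable {α : ℝ} (hα : 0 < α) (ε : ℝ)

/-- The symbol `(p² + ε²p⁴ + α)^(-1/2)`. -/
def greenSymbol : BoundedContinuousFunction (Space d) ℝ :=
  BoundedContinuousFunction.ofNormedAddCommGroup (fun ξ => (rootSymbol α ε ξ)⁻¹)
    ((continuous_rootSymbol α ε).inv₀ fun ξ => (rootSymbol_pos hα ε ξ).ne') (√α)⁻¹ fun ξ => by
      rw [Real.norm_of_nonneg (inv_nonneg.2 (rootSymbol_pos hα ε ξ).le)]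
      exact inv_anti₀ (Real.sqrt_pos.2 hα)
        (Real.sqrt_le_sqrt (by linarith [symbol_nonneg ε ξ]))

theorem greenSymbol_apply (ξ : Space d) : greenSymbol hα ε ξ = (rootSymbol α ε ξ)⁻¹ := rfl

theorem greenSymbol_sq_mul (ξ : Space d) : greenSymbol hα ε ξ ^ 2 * (symbol ε ξ + α) = 1 := by
  have := (rootSymbol_pos hα ε ξ).ne'
  rw [greenSymbol_apply, ← rootSymbol_sq hα]
  field_simp

/-- The symbol `(p² + α)^(1/2) (p² + ε²p⁴ + α)^(-1/2)`. -/
def ratioSymbol : BoundedContinuousFunction (Space d) ℝ :=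
  BoundedContinuousFunction.ofNormedAddCommGroup
    (fun ξ => rootSymbol α 0 ξ * greenSymbol hα ε ξ)
    ((continuous_rootSymbol α 0).mul (greenSymbol hα ε).continuous) 1 fun ξ => by
      rw [Real.norm_eq_abs, ← sq_le_one_iff_abs_le_one, mul_pow, rootSymbol_sq hα,
        ← greenSymbol_sq_mul hα ε ξ, symbol_eq ε]
      nlinarith [mul_nonneg (sq_nonneg (greenSymbol hα ε ξ))
        (mul_nonneg (sq_nonneg ε) (sq_nonneg (symbol 0 ξ)))]

/-- The symbol `ε p² (p² + ε²p⁴ + α)^(-1/2)`. -/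
def defectSymbol : BoundedContinuousFunction (Space d) ℝ :=
  BoundedContinuousFunction.ofNormedAddCommGroup
    (fun ξ => ε * symbol 0 ξ * greenSymbol hα ε ξ)
    ((continuous_const.mul (continuous_symbol 0)).mul (greenSymbol hα ε).continuous) 1 fun ξ => by
      rw [Real.norm_eq_abs, ← sq_le_one_iff_abs_le_one, mul_pow,
        ← greenSymbol_sq_mul hα ε ξ, symbol_eq ε]
      nlinarith [mul_nonneg (sq_nonneg (greenSymbol hα ε ξ)) (symbol_nonneg 0 ξ),
        mul_nonneg (sq_nonneg (greenSymbol hα ε ξ)) hα.le]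

/-- The symbol `(1 + p²)^(1/2) (p² + α)^(-1/2)`. -/
def comparisonSymbol : BoundedContinuousFunction (Space d) ℝ :=
  BoundedContinuousFunction.ofNormedAddCommGroup
    (fun ξ => sobolevWeight 1 ξ * greenSymbol hα 0 ξ)
    ((continuous_sobolevWeight 1).mul (greenSymbol hα 0).continuous) (1 + 1 / α) fun ξ => by
      have h1 : (1 + 1 / α) * (symbol 0 ξ + α) = symbol 0 ξ + α + symbol 0 ξ / α + 1 := by
        field_simp; ring
      have h2 := div_nonneg (symbol_nonneg 0 ξ) hα.le
      have h3 : (0 : ℝ) ≤ 1 / α := by positivity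
      rw [Real.norm_eq_abs]
      refine abs_le_of_sq_le_sq ?_ (by positivity)
      rw [mul_pow, sobolevWeight_one_sq, ← symbol_zero]
      calc (1 + symbol 0 ξ) * greenSymbol hα 0 ξ ^ 2
          ≤ ((1 + 1 / α) * (symbol 0 ξ + α)) * greenSymbol hα 0 ξ ^ 2 :=
            mul_le_mul_of_nonneg_right (by linarith) (sq_nonneg _)
        _ = (1 + 1 / α) * (greenSymbol hα 0 ξ ^ 2 * (symbol 0 ξ + α)) := by ring
        _ = 1 + 1 / α := by rw [greenSymbol_sq_mul, mul_one]
        _ ≤ (1 + 1 / α) ^ 2 := by nlinarith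

theorem greenSymbol_zero_mul_ratioSymbol :
    greenSymbol hα 0 * ratioSymbol (d := d) hα ε = greenSymbol hα ε := by
  ext ξ
  change (rootSymbol α 0 ξ)⁻¹ * (rootSymbol α 0 ξ * greenSymbol hα ε ξ) = _
  rw [inv_mul_cancel_left₀ (rootSymbol_pos hα 0 ξ).ne']

theorem invWeight_mul_comparisonSymbol :
    invWeight * comparisonSymbol (d := d) hα = greenSymbol hα 0 := by
  ext ξ
  change invWeight ξ * (sobolevWeight 1 ξ * greenSymbol hα 0 ξ) = _
  rw [← mul_assoc, mul_comm (invWeight ξ), sobolevWeight_mul_invWeight, one_mul]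

theorem ratioSymbol_zero : ratioSymbol (d := d) hα 0 = 1 := by
  ext ξ
  exact mul_inv_cancel₀ (rootSymbol_pos hα 0 ξ).ne'

/-- The terms `p² + α` and `ε²p⁴` are the two parts of the denominator `p² + ε²p⁴ + α`. -/
theorem ratioSymbol_sq_add :
    ratioSymbol (d := d) hα ε * ratioSymbol hα ε + defectSymbol hα ε * defectSymbol hα ε = 1 := by
  ext ξ
  change rootSymbol α 0 ξ * greenSymbol hα ε ξ * (rootSymbol α 0 ξ * greenSymbol hα ε ξ) +
    ε * symbol 0 ξ * greenSymbol hα ε ξ * (ε * symbol 0 ξ * greenSymbol hα ε ξ) = 1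
  have h1 := greenSymbol_sq_mul hα ε ξ
  rw [symbol_eq] at h1
  linear_combination h1 + greenSymbol hα ε ξ ^ 2 * rootSymbol_sq hα 0 ξ

theorem defectSymbol_sq (ξ : Space d) :
    defectSymbol hα ε ξ ^ 2 = ε ^ 2 * symbol 0 ξ ^ 2 * greenSymbol hα ε ξ ^ 2 := by
  change (ε * symbol 0 ξ * greenSymbol hα ε ξ) ^ 2 = _
  ring

/-- In the square `ε²p⁴`, one factor `p²` is absorbed by `p² + ε²p⁴ + α` and the other by `p² + α`.
-/
theorem abs_defectSymbol_mul_greenSymbol_le (hε : 0 ≤ ε) (ξ : Space d) :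
    |(defectSymbol hα ε * greenSymbol hα 0 : BoundedContinuousFunction (Space d) ℝ) ξ| ≤ ε := by
  refine abs_le_of_sq_le_sq ?_ hε
  change (defectSymbol hα ε ξ * greenSymbol hα 0 ξ) ^ 2 ≤ _
  rw [mul_pow, defectSymbol_sq]
  have h1 := greenSymbol_sq_mul hα ε ξ
  have h2 := greenSymbol_sq_mul hα 0 ξ
  have h0 := symbol_nonneg 0 ξ
  have h3 : symbol 0 ξ ≤ symbol ε ξ := by
    rw [symbol_eq ε]; nlinarith [mul_nonneg (sq_nonneg ε) (sq_nonneg (symbol 0 ξ))]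
  set g := greenSymbol hα ε ξ ^ 2
  set g₀ := greenSymbol hα 0 ξ ^ 2
  have hg : 0 ≤ g := sq_nonneg _
  have hg₀ : 0 ≤ g₀ := sq_nonneg _
  have a1 : g * symbol 0 ξ ≤ 1 := by nlinarith [mul_nonneg hg hα.le]
  have a2 : g₀ * symbol 0 ξ ≤ 1 := by nlinarith [mul_nonneg hg₀ hα.le]
  calc ε ^ 2 * symbol 0 ξ ^ 2 * g * g₀ = ε ^ 2 * ((g * symbol 0 ξ) * (g₀ * symbol 0 ξ)) := by ring
    _ ≤ ε ^ 2 * 1 := mul_le_mul_of_nonneg_left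
        (mul_le_one₀ a1 (mul_nonneg hg₀ h0) a2) (sq_nonneg _)
    _ = ε ^ 2 := mul_one _

/-- This is the pointwise condition under which `(B_{η,β})` gives `‖TE‖ ≤ √η`. The critical term `β
ε² p⁴` is dominated by the `p² · p²` in the product of the denominators, which is where `ε²β ≤ 1`
enters. -/
theorem symbol_add_mul_defectSymbol_sq_le {β : ℝ} (hβ : ε ^ 2 * β ≤ 1) (ξ : Space d) :
    (symbol 0 ξ + β) * greenSymbol hα 0 ξ ^ 2 * defectSymbol hα ε ξ ^ 2 ≤ 1 := by
  rw [defectSymbol_sq]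
  have h1 := greenSymbol_sq_mul hα ε ξ
  have h2 := greenSymbol_sq_mul hα 0 ξ
  have h0 := symbol_nonneg 0 ξ
  rw [symbol_eq ε] at h1
  set x := symbol 0 ξ
  set g := greenSymbol hα ε ξ ^ 2
  set g₀ := greenSymbol hα 0 ξ ^ 2
  have hg : 0 ≤ g * g₀ := mul_nonneg (sq_nonneg _) (sq_nonneg _)
  have key : (x + β) * (ε ^ 2 * x ^ 2) ≤ (x + ε ^ 2 * x ^ 2 + α) * (x + α) := by
    have a1 : (ε ^ 2 * β) * x ^ 2 ≤ 1 * x ^ 2 := mul_le_mul_of_nonneg_right hβ (sq_nonneg _)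
    have a2 : 0 ≤ α * x + α * x + α * (ε ^ 2 * x ^ 2) + α ^ 2 := by positivity
    linarith
  calc (x + β) * g₀ * (ε ^ 2 * x ^ 2 * g) = ((x + β) * (ε ^ 2 * x ^ 2)) * (g * g₀) := by ring
    _ ≤ ((x + ε ^ 2 * x ^ 2 + α) * (x + α)) * (g * g₀) := mul_le_mul_of_nonneg_right key hg
    _ = (g * (x + ε ^ 2 * x ^ 2 + α)) * (g₀ * (x + α)) := by ring
    _ = 1 := by rw [h1, h2, one_mul]

/-! ### The free resolvent -/

theorem fourierMul_greenSymbol_mem (f : L2 d) :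
    fourierMul (greenSymbol hα ε) f ∈ formDomain d ε := by
  obtain ⟨C, hC⟩ := sobolevWeight_le_rootSymbol (d := d) hα ε
  refine (MemLp.of_le_mul (c := C) (Lp.memLp (𝓕 f : L2 d)) (aestronglyMeasurable_weight _ _)
    ?_).2
  filter_upwards [fourier_fourierMul (greenSymbol hα ε) f] with ξ h
  have hp := rootSymbol_pos hα ε ξ
  rw [h, norm_mul, norm_mul, Complex.norm_real, Complex.norm_real, greenSymbol_apply,
    Real.norm_of_nonneg (sobolevWeight_pos _ ξ).le, Real.norm_of_nonneg (inv_nonneg.2 hp.le),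
    ← mul_assoc]
  refine mul_le_mul_of_nonneg_right ?_ (norm_nonneg _)
  rw [← div_eq_mul_inv, div_le_iff₀ hp]
  exact hC ξ

theorem exists_fourierMul_greenSymbol_eq {u : L2 d} (hu : u ∈ formDomain d ε) :
    ∃ f, fourierMul (greenSymbol hα ε) f = u := by
  obtain ⟨C, hC⟩ := rootSymbol_le_sobolevWeight (d := d) hα ε
  have hm : MemLp (fun ξ => (rootSymbol α ε ξ : ℂ) * (𝓕 u : L2 d) ξ) 2 volume := by
    refine MemLp.of_le_mul (c := C) (memLp_of_mem_sobolev hu) ?_ (Eventually.of_forall fun ξ => ?_)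
    · exact (Complex.continuous_ofReal.comp (continuous_rootSymbol α ε)).aestronglyMeasurable.mul
        (Lp.aestronglyMeasurable _)
    · rw [norm_mul, norm_mul, Complex.norm_real, Complex.norm_real,
        Real.norm_of_nonneg (sobolevWeight_pos _ ξ).le,
        Real.norm_of_nonneg (rootSymbol_pos hα ε ξ).le, ← mul_assoc]
      exact mul_le_mul_of_nonneg_right (hC ξ) (norm_nonneg _)
  refine ⟨ofFourier hm, eq_of_fourier_ae_eq ?_⟩
  filter_upwards [fourier_fourierMul (greenSymbol hα ε) (ofFourier hm), fourier_ofFourier hm]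
    with ξ h1 h2
  rw [h1, h2, ← mul_assoc, ← Complex.ofReal_mul, greenSymbol_apply,
    inv_mul_cancel₀ (rootSymbol_pos hα ε ξ).ne', Complex.ofReal_one, one_mul]

/-- The symbol `p² + ε²p⁴` equals the inverse square of the Green symbol minus `α`. -/
theorem freeForm_fourierMul_greenSymbol (f f' : L2 d) :
    freeForm d ε ⟨_, fourierMul_greenSymbol_mem hα ε f⟩ ⟨_, fourierMul_greenSymbol_mem hα ε f'⟩ =
      inner ℂ f f' - α * inner ℂ (fourierMul (greenSymbol hα ε) f)
        (fourierMul (greenSymbol hα ε) f') := by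
  have hint (u v : L2 d) : Integrable fun ξ => conj ((𝓕 u : L2 d) ξ) * (𝓕 v : L2 d) ξ :=
    integrable_pairing le_rfl (𝓕 v : L2 d) (𝓕 u : L2 d)
  rw [inner_eq_integral_fourier, inner_eq_integral_fourier, ← integral_const_mul,
    ← integral_sub (hint _ _) ((hint _ _).const_mul _)]
  refine integral_congr_ae ?_
  filter_upwards [fourier_fourierMul (greenSymbol hα ε) f,
    fourier_fourierMul (greenSymbol hα ε) f'] with ξ h1 h2
  have h3 : (greenSymbol hα ε ξ : ℂ) ^ 2 * (symbol ε ξ + α) = 1 := by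
    exact_mod_cast greenSymbol_sq_mul hα ε ξ
  simp only [h1, h2, map_mul, Complex.conj_ofReal]
  linear_combination (conj ((𝓕 f : L2 d) ξ) * (𝓕 f' : L2 d) ξ) * h3

end Symbols

/-! ### The measure form -/

section MeasureForm

variable {d : ℕ} (m : RealRadonMeasure d)

theorem RealRadonMeasure.form_apply (b a : Lp ℂ 2 m.abs) :
    m.form b a = (∫ x, conj (b x) * a x ∂m.pos) - ∫ x, conj (b x) * a x ∂m.neg := rfl

theorem RealRadonMeasure.conj_form (b a : Lp ℂ 2 m.abs) : conj (m.form b a) = m.form a b := by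
  rw [m.form_apply, m.form_apply, map_sub, ← integral_conj, ← integral_conj]
  simp only [map_mul, Complex.conj_conj, mul_comm]

/-- The integrals against `m⁺` and `m⁻` of the absolute value add up to one against `|m|`, where
Cauchy–Schwarz applies. -/
theorem RealRadonMeasure.norm_form_le (b a : Lp ℂ 2 m.abs) : ‖m.form b a‖ ≤ ‖b‖ * ‖a‖ := by
  have hi := (integrable_pairing le_rfl a b).norm
  have h1 : ∫ x, ‖conj (b x) * a x‖ ∂m.abs = (∫ x, ‖conj (b x) * a x‖ ∂m.pos) +
      ∫ x, ‖conj (b x) * a x‖ ∂m.neg :=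
    integral_add_measure (hi.mono_measure m.pos_le_abs) (hi.mono_measure m.neg_le_abs)
  have h2 : ∫ x, ‖conj (b x) * a x‖ ∂m.abs ≤ ‖b‖ * ‖a‖ := by
    have h := integral_mul_le_Lp_mul_Lq_of_nonneg (μ := m.abs) Real.HolderConjugate.two_two
      (f := fun x => ‖b x‖) (g := fun x => ‖a x‖) (Eventually.of_forall fun x => norm_nonneg _)
      (Eventually.of_forall fun x => norm_nonneg _) (by simpa using (Lp.memLp b).norm)
      (by simpa using (Lp.memLp a).norm)
    simp only [Real.rpow_two, ← norm_sq_eq_integral_norm_sq, ← Real.sqrt_eq_rpow,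
      Real.sqrt_sq (norm_nonneg _)] at h
    simpa only [norm_mul, RCLike.norm_conj] using h
  calc ‖m.form b a‖ ≤ ‖∫ x, conj (b x) * a x ∂m.pos‖ + ‖∫ x, conj (b x) * a x ∂m.neg‖ :=
        norm_sub_le _ _
    _ ≤ (∫ x, ‖conj (b x) * a x‖ ∂m.pos) + ∫ x, ‖conj (b x) * a x‖ ∂m.neg :=
        add_le_add (norm_integral_le_integral_norm _) (norm_integral_le_integral_norm _)
    _ ≤ ‖b‖ * ‖a‖ := h1 ▸ h2

/-- The operator on `L²(|m|)` with sesquilinear form `∫ conj(b) a dm`. -/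
def RealRadonMeasure.signOp : Lp ℂ 2 m.abs →L[ℂ] Lp ℂ 2 m.abs :=
  InnerProductSpace.continuousLinearMapOfBilin
    (m.form.mkContinuous₂ 1 fun b a => by rw [one_mul]; exact m.norm_form_le b a)

theorem RealRadonMeasure.inner_signOp (b a : Lp ℂ 2 m.abs) :
    inner ℂ (m.signOp b) a = m.form b a :=
  InnerProductSpace.continuousLinearMapOfBilin_apply _ _ _

theorem RealRadonMeasure.inner_signOp_right (b a : Lp ℂ 2 m.abs) :
    inner ℂ b (m.signOp a) = m.form b a := by
  rw [← inner_conj_symm, m.inner_signOp, m.conj_form]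

theorem RealRadonMeasure.norm_signOp_le : ‖m.signOp‖ ≤ 1 := by
  refine ContinuousLinearMap.opNorm_le_bound _ zero_le_one fun b => ?_
  rw [one_mul]
  have h := m.norm_form_le b (m.signOp b)
  rw [← m.inner_signOp, inner_self_eq_norm_sq_to_K, norm_pow, RCLike.norm_ofReal, abs_norm,
    sq] at h
  rcases (norm_nonneg (m.signOp b)).eq_or_lt with h0 | h0
  · rw [← h0]; exact norm_nonneg _
  · exact le_of_mul_le_mul_right h h0

open ContinuousLinearMap in
/-- The operator with sesquilinear form `∫ conj(T v) (T u) dm`. -/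
def RealRadonMeasure.pullback (T : L2 d →L[ℂ] Lp ℂ 2 m.abs) : L2 d →L[ℂ] L2 d :=
  (adjoint T).comp (m.signOp.comp T)

theorem RealRadonMeasure.inner_pullback (T : L2 d →L[ℂ] Lp ℂ 2 m.abs) (v u : L2 d) :
    inner ℂ v (m.pullback T u) = m.form (T v) (T u) := by
  rw [← m.inner_signOp_right]
  exact ContinuousLinearMap.adjoint_inner_right T v _

theorem RealRadonMeasure.pullback_isSelfAdjoint (T : L2 d →L[ℂ] Lp ℂ 2 m.abs) :
    IsSelfAdjoint (m.pullback T) := by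
  rw [ContinuousLinearMap.isSelfAdjoint_iff_isSymmetric]
  intro u v
  change inner ℂ (m.pullback T u) v = inner ℂ u (m.pullback T v)
  rw [m.inner_pullback, ← inner_conj_symm, m.inner_pullback, m.conj_form]

/-- Keeping `E` attached to the right-hand `T` is essential: `TE` is the factor that a form bound
makes small. -/
theorem RealRadonMeasure.norm_pullback_mul_le (T : L2 d →L[ℂ] Lp ℂ 2 m.abs)
    (E : L2 d →L[ℂ] L2 d) : ‖m.pullback T * E‖ ≤ ‖T‖ * ‖T.comp E‖ := by
  have e : m.pullback T * E = (ContinuousLinearMap.adjoint T).comp (m.signOp.comp (T.comp E)) :=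
    rfl
  rw [e]
  refine (ContinuousLinearMap.opNorm_comp_le _ _).trans ?_
  rw [LinearIsometryEquiv.norm_map]
  refine mul_le_mul_of_nonneg_left ?_ (norm_nonneg _)
  exact (ContinuousLinearMap.opNorm_comp_le _ _).trans
    (mul_le_of_le_one_left (norm_nonneg _) m.norm_signOp_le)

end MeasureForm

/-! ### The perturbed resolvents -/

section Main

variable {d : ℕ}

/-- The trace map precomposed with `(-Δ + α)^(-1/2)`. -/
theorem exists_traceMap_comp_green {m : RealRadonMeasure d} {α η₀ β₀ : ℝ} (hα : 0 < α)
    (h₀ : FormBound m η₀ β₀) : ∃ T : L2 d →L[ℂ] Lp ℂ 2 m.abs,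
      (∀ a (ha : fourierMul (greenSymbol hα 0) a ∈ sobolev d 1), traceMap m ⟨_, ha⟩ = T a) ∧
      ∀ η β, 0 ≤ η → FormBound m η β → ∀ φ : BoundedContinuousFunction (Space d) ℝ,
        (∀ ξ, (symbol 0 ξ + β) * greenSymbol hα 0 ξ ^ 2 * φ ξ ^ 2 ≤ 1) →
          ‖T.comp (fourierMul φ)‖ ≤ √η := by
  obtain ⟨T, hT, hb⟩ := exists_traceMap_factor h₀
  -- Composing `J_m (1 - Δ)^(-1/2)` with the multiplier `(1 - Δ)^(1/2) (-Δ + α)^(-1/2)` gives `J_m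
  -- (-Δ + α)^(-1/2)`.
  refine ⟨T.comp (fourierMul (comparisonSymbol hα)), fun a ha => ?_, fun η β hη h φ hφ => ?_⟩
  · rw [hT, ContinuousLinearMap.comp_apply]
    congr 1
    have e : fourierMul (greenSymbol hα 0) a =
        fourierMul invWeight (fourierMul (comparisonSymbol hα) a) := by
      rw [← invWeight_mul_comparisonSymbol, ← fourierMul_mul, mul_apply_eq_comp]
    rw [← besselMap_fourierMul_invWeight (fourierMul (comparisonSymbol hα) a)]
    congr 1
    exact Subtype.ext e
  · refine ContinuousLinearMap.opNorm_le_bound _ (Real.sqrt_nonneg _) fun u => ?_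
    refine le_sqrt_mul_of_sq_le (norm_nonneg _) hη ?_
    have h1 := hb η β h (fourierMul (comparisonSymbol hα) (fourierMul φ u))
    refine h1.trans (mul_le_mul_of_nonneg_left ?_ hη)
    simp only [← mul_apply_eq_comp, fourierMul_mul]
    refine (norm_sq_fourierMul_add_le (C := 1) (fun ξ => ?_) u).trans_eq (one_mul _)
    have e : invWeight ξ * comparisonSymbol hα ξ = greenSymbol hα 0 ξ :=
      congrArg (fun ψ : BoundedContinuousFunction (Space d) ℝ => ψ ξ)
        (invWeight_mul_comparisonSymbol hα)
    have h2 := hφ ξ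
    rw [← e, symbol_zero] at h2
    change (gradWeight ξ * (comparisonSymbol hα ξ * φ ξ)) ^ 2 +
      β * (invWeight ξ * (comparisonSymbol hα ξ * φ ξ)) ^ 2 ≤ 1
    rw [gradWeight_apply]
    linarith

/-- The square root lies in `[0, 1]`, so `1/(2ε²) ≤ β(ε) ≤ 1/ε²`, while smallness gives `α <
1/(4ε²)`. The lower bound makes `(B_{c,α})` pass to `(B_{c,β(ε)})`. -/
theorem betaParam_bounds {α ε : ℝ} (hα : 0 < α) (hε : 0 < ε) (h : 4 * ε ^ 2 * α < 1) :
    ε ^ 2 * betaParam α ε ≤ 1 ∧ α ≤ betaParam α ε := by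
  have hs : √(1 - 4 * ε ^ 2 * α) ≤ 1 :=
    Real.sqrt_le_one.2 (by have : 0 ≤ 4 * ε ^ 2 * α := by positivity
                           linarith)
  have h1 : 1 / (2 * ε ^ 2) ≤ betaParam α ε := by
    unfold betaParam
    gcongr
    linarith [Real.sqrt_nonneg (1 - 4 * ε ^ 2 * α)]
  refine ⟨?_, le_trans ?_ h1⟩
  · have e : ε ^ 2 * betaParam α ε = (1 + √(1 - 4 * ε ^ 2 * α)) / 2 := by
      unfold betaParam; field_simp
    rw [e]; linarith
  · rw [le_div_iff₀ (by positivity)]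
    have : 0 ≤ ε ^ 2 * α := by positivity
    linarith

theorem tendsto_betaParam (α : ℝ) : Tendsto (betaParam α) (𝓝[>] 0) atTop := by
  have h1 : Tendsto (fun ε : ℝ => (ε ^ 2)⁻¹ / 2) (𝓝[>] 0) atTop := by
    refine Tendsto.atTop_div_const two_pos ?_
    refine tendsto_inv_nhdsGT_zero.comp (tendsto_nhdsWithin_iff.2 ⟨?_, ?_⟩)
    · have : Tendsto (fun ε : ℝ => ε ^ 2) (𝓝 0) (𝓝 (0 ^ 2)) := (continuous_pow 2).tendsto 0
      rw [zero_pow two_ne_zero] at this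
      exact this.mono_left nhdsWithin_le_nhds
    · filter_upwards [self_mem_nhdsWithin] with ε (hε : 0 < ε)
      exact pow_pos hε 2
  -- The comparison holds for every real `ε`: the root is nonnegative even where its argument is
  -- negative, and both sides are `0` at `ε = 0`.
  refine tendsto_atTop_mono (fun ε => ?_) h1
  unfold betaParam
  rw [← one_div, div_div, mul_comm (ε ^ 2)]
  gcongr
  linarith [Real.sqrt_nonneg (1 - 4 * ε ^ 2 * α)]

theorem eventually_small (α : ℝ) : ∀ᶠ ε : ℝ in 𝓝[>] 0, 0 < ε ∧ 4 * ε ^ 2 * α < 1 := by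
  refine (eventually_mem_nhdsWithin (s := Set.Ioi (0 : ℝ))).and
    (Filter.Eventually.filter_mono nhdsWithin_le_nhds ?_)
  have h : Continuous fun ε : ℝ => 4 * ε ^ 2 * α := by fun_prop
  exact (h.tendsto 0).eventually_lt_const (by norm_num)

/-- For every `ε` there is a bounded self-adjoint injective inverse of `-Δ + ε²Δ² + m + α`, and
these inverses differ from the one for `ε = 0` by `O(ε² + η)`. -/
theorem exists_shiftedInverse {m : RealRadonMeasure d} {c α : ℝ} (hc : c < 1) (hα : 0 < α)
    (h : FormBound m c α) : ∃ R : ℝ → L2 d →L[ℂ] L2 d,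
      (∀ ε, IsShiftedInverseGraph (formGraph (formDomain d ε) (perturbedForm m ε)) α (R ε) ∧
        (∀ f, R ε f = 0 → f = 0) ∧ IsSelfAdjoint (R ε)) ∧
      ∃ C : ℝ, ∀ ε : ℝ, 0 < ε → 4 * ε ^ 2 * α < 1 → ∀ η : ℝ, FormBound m η (betaParam α ε) →
        ‖R ε - R 0‖ ≤ C * (ε ^ 2 + η) := by
  have hc0 : 0 ≤ c := h.nonneg hα
  obtain ⟨T, hT, hTb⟩ := exists_traceMap_comp_green hα h
  have hT1 : ‖T‖ ≤ √c := by
    -- With `β = α` the symbol condition is an equality for the constant multiplier `1`.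
    have := hTb c α hc0 h 1 fun ξ => by
      have := greenSymbol_sq_mul hα 0 ξ
      rw [mul_comm] at this
      simp [this]
    rwa [fourierMul_one, ContinuousLinearMap.one_def, ContinuousLinearMap.comp_id] at this
  set B := m.pullback T with hBdef
  have hBsa : IsSelfAdjoint B := m.pullback_isSelfAdjoint T
  have hB : ‖B‖ ≤ c := by
    have h1 := m.norm_pullback_mul_le T 1
    rw [mul_one, ContinuousLinearMap.one_def, ContinuousLinearMap.comp_id] at h1
    calc ‖B‖ ≤ ‖T‖ * ‖T‖ := h1
      _ ≤ √c * √c := mul_le_mul hT1 hT1 (norm_nonneg _) (Real.sqrt_nonneg _)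
      _ = c := Real.mul_self_sqrt hc0
  set K : ℝ → L2 d →L[ℂ] L2 d := fun ε => fourierMul (ratioSymbol hα ε) with hK
  have hKsa (ε : ℝ) : IsSelfAdjoint (K ε) := fourierMul_isSelfAdjoint _
  have hKsym (ε : ℝ) (x y : L2 d) : inner ℂ (K ε x) y = inner ℂ x (K ε y) :=
    ContinuousLinearMap.isSelfAdjoint_iff_isSymmetric.1 (hKsa ε) x y
  have hK1 (ε : ℝ) : ‖K ε‖ ≤ 1 := norm_fourierMul_le zero_le_one fun ξ =>
    (BoundedContinuousFunction.norm_coe_le_norm (ratioSymbol hα ε) ξ).trans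
      (BoundedContinuousFunction.norm_ofNormedAddCommGroup_le _ zero_le_one _)
  have hKBK (ε : ℝ) : ‖K ε * B * K ε‖ < 1 := by
    refine lt_of_le_of_lt ?_ hc
    refine (norm_mul_le _ _).trans
      ((mul_le_of_le_one_right (norm_nonneg _) (hK1 ε)).trans ?_)
    exact (norm_mul_le _ _).trans
      ((mul_le_of_le_one_left (norm_nonneg _) (hK1 ε)).trans hB)
  have hKBKsa (ε : ℝ) : IsSelfAdjoint (K ε * B * K ε) := by
    have := hBsa.conjugate (K ε)
    rwa [(hKsa ε).star_eq] at this
  set G := fourierMul (greenSymbol (d := d) hα 0) with hG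
  have hGK (ε : ℝ) : fourierMul (greenSymbol hα ε) = G * K ε := by
    rw [hG, hK, fourierMul_mul, greenSymbol_zero_mul_ratioSymbol]
  refine ⟨fun ε => perturbedInverse (fourierMul (greenSymbol hα ε)) (K ε * B * K ε),
    fun ε => ⟨?_, ?_, ?_⟩, ?_⟩
  · refine isShiftedInverseGraph_formGraph (fourierMul_isSelfAdjoint _) (hKBK ε)
      (fourierMul_greenSymbol_mem hα ε) (fun u hu => exists_fourierMul_greenSymbol_eq hα ε hu)
      fun f f' => ?_
    -- Since `G_ε = G K`, the trace of `G_ε a` is `T K a`. Self-adjointness of `K` then turns the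
    -- measure form into `⟪f, K B K f'⟫`.
    have htr (a : L2 d) :
        formTrace m ε ⟨_, fourierMul_greenSymbol_mem hα ε a⟩ = T (K ε a) := by
      have e : fourierMul (greenSymbol hα ε) a = G (K ε a) := by
        rw [hGK, mul_apply_eq_comp]
      have hm : G (K ε a) ∈ sobolev d 1 := e ▸ formDomain_le ε (fourierMul_greenSymbol_mem hα ε a)
      rw [← hT _ hm]
      exact congrArg (traceMap m) (Subtype.ext e)
    change freeForm d ε _ _ + m.form (formTrace m ε _) (formTrace m ε _) = _
    rw [freeForm_fourierMul_greenSymbol, htr, htr, ← m.inner_pullback, hKsym]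
    rfl
  · refine perturbedInverse_injective (fun f hf => fourierMul_injective (fun ξ => ?_) hf) (hKBK ε)
    exact inv_ne_zero (rootSymbol_pos hα ε ξ).ne'
  · exact perturbedInverse_isSelfAdjoint (fourierMul_isSelfAdjoint _) (hKBKsa ε)
  -- With `q = ‖G‖ / (1 - c)`, the abstract bound `(ε + q√η)²` is at most `2ε² + 2q²η`.
  · refine ⟨2 + 2 * (‖G‖ / (1 - c)) ^ 2, fun ε hε hsmall η hη => ?_⟩
    obtain ⟨hβ1, hβ2⟩ := betaParam_bounds hα hε hsmall
    have hη0 : 0 ≤ η := hη.nonneg (hα.trans_le hβ2)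
    set E := fourierMul (defectSymbol (d := d) hα ε) with hE
    have hEG : ‖E * G‖ ≤ ε := by
      rw [hE, hG, fourierMul_mul]
      exact norm_fourierMul_le hε.le (abs_defectSymbol_mul_greenSymbol_le hα ε hε.le)
    have hGE : ‖G * E‖ ≤ ε := by rwa [← (fourierMul_comm _ _ : Commute E G).eq]
    have hBE : ‖B * E‖ ≤ √η := by
      have h1 := hTb η _ hη0 hη (defectSymbol hα ε)
        (symbol_add_mul_defectSymbol_sq_le hα ε hβ1)
      have h2 : ‖T‖ ≤ 1 := hT1.trans (Real.sqrt_le_one.2 hc.le)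
      exact (m.norm_pullback_mul_le T E).trans
        ((mul_le_of_le_one_left (norm_nonneg _) h2).trans h1)
    have hEB : ‖E * B‖ ≤ √η := by
      rw [← norm_star, star_mul, hBsa.star_eq, (fourierMul_isSelfAdjoint _).star_eq]
      exact hBE
    have hKE : K ε * K ε + E * E = 1 := by
      rw [hK, hE, fourierMul_mul, fourierMul_mul, fourierMul_add, ratioSymbol_sq_add,
        fourierMul_one]
    have hmain := norm_perturbedInverse_sub_le hc hB (hK1 ε) (fourierMul_comm _ _) hKE hEG hGE
      hEB hBE
    -- At `ε = 0` the general inverse is the unmodified `G (1 + B)⁻¹ G`.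
    have hK0 : K 0 = 1 := by rw [hK]; simp only [ratioSymbol_zero, fourierMul_one]
    simp only [hK0, one_mul, mul_one, hGK]
    refine hmain.trans ?_
    have hsq := Real.sq_sqrt hη0
    set q := ‖G‖ / (1 - c)
    nlinarith [sq_nonneg (ε - q * √η), sq_nonneg q, mul_nonneg (sq_nonneg q) (sq_nonneg ε)]

theorem tendsto_optimalBound_betaParam {m : RealRadonMeasure d}
    (hm : ∀ η : ℝ, 0 < η → ∃ β : ℝ, FormBound m η β) (α : ℝ) :
    Tendsto (fun ε => optimalBound m (betaParam α ε)) (𝓝[>] 0) (𝓝 0) :=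
  (tendsto_optimalBound hm).comp (tendsto_betaParam α)

theorem formBound_optimalBound_betaParam {m : RealRadonMeasure d} {c α ε : ℝ} (hα : 0 < α)
    (h : FormBound m c α) (hε : 0 < ε) (hsmall : 4 * ε ^ 2 * α < 1) :
    FormBound m (optimalBound m (betaParam α ε)) (betaParam α ε) := by
  obtain ⟨-, hβ⟩ := betaParam_bounds hα hε hsmall
  exact formBound_optimalBound (h.mono_right (h.nonneg hα) hβ) (hα.trans_le hβ)

end Main

end MeasurePerturbation

end

/-! ### Self-adjointness, norm resolvent convergence and the rate -/

open MeasurePerturbation in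
theorem theorem6 (d : ℕ) (m : RealRadonMeasure d)
    (hm : ∀ η : ℝ, 0 < η → ∃ β : ℝ, FormBound m η β) :
    (∀ ε : ℝ, 0 ≤ ε → IsSelfAdjoint (schrodinger m ε)) ∧
    NormResolventTendsto (fun ε : ℝ => schrodinger m ε) (𝓝[>] 0) (schrodinger m 0) ∧
    ∀ c α : ℝ, c < 1 → 0 < α → FormBound m c α →
      (∀ ε : ℝ, 0 ≤ ε → (-α : ℂ) ∈ resolventSetOf (schrodinger m ε)) ∧
      (∃ η : ℝ → ℝ, Tendsto η (𝓝[>] 0) (𝓝 0) ∧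
        ∀ ε : ℝ, 0 < ε → 4 * ε ^ 2 * α < 1 → FormBound m (η ε) (betaParam α ε)) ∧
      ∃ C : ℝ, ∀ ε : ℝ, 0 < ε → 4 * ε ^ 2 * α < 1 →
        ∀ η : ℝ, FormBound m η (betaParam α ε) →
          ‖resolventOf (schrodinger m ε) (-α) - resolventOf (schrodinger m 0) (-α)‖
            ≤ C * (ε ^ 2 + η) := by
  -- Any constant below `1` serves to produce one admissible shift; the maximum with `1` makes that
  -- shift positive.
  obtain ⟨β₀, hβ₀⟩ := hm (1 / 2) (by norm_num)
  have h₀ : FormBound m (1 / 2) (max β₀ 1) := hβ₀.mono_right (by norm_num) (le_max_left _ _)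
  have hα₀ : (0 : ℝ) < max β₀ 1 := one_pos.trans_le (le_max_right _ _)
  obtain ⟨R, hR, C, hC⟩ := exists_shiftedInverse (by norm_num) hα₀ h₀
  refine ⟨fun ε _ => (hR ε).1.isSelfAdjoint (hR ε).2.1 (hR ε).2.2, ?_, ?_⟩
  · refine normResolventTendsto_of_tendsto (Eventually.of_forall hR) (hR 0).1 (hR 0).2.1
      (hR 0).2.2 ?_
    rw [tendsto_iff_norm_sub_tendsto_zero]
    refine squeeze_zero' (g := fun ε : ℝ => C * (ε ^ 2 + optimalBound m (betaParam (max β₀ 1) ε)))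
      (Eventually.of_forall fun _ => norm_nonneg _) ?_ ?_
    · filter_upwards [eventually_small (max β₀ 1)] with ε hε
      exact hC ε hε.1 hε.2 _ (formBound_optimalBound_betaParam hα₀ h₀ hε.1 hε.2)
    · have h1 : Tendsto (fun ε : ℝ => ε ^ 2) (𝓝[>] 0) (𝓝 (0 ^ 2)) :=
        ((continuous_pow 2).tendsto 0).mono_left nhdsWithin_le_nhds
      simpa using (h1.add (tendsto_optimalBound_betaParam hm (max β₀ 1))).const_mul C
  · intro c α hc hα h
    -- The construction is repeated at the prescribed `α`, since the inverses used so far belong to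
    -- an auxiliary shift.
    obtain ⟨R, hR, C, hC⟩ := exists_shiftedInverse hc hα h
    have hres (ε : ℝ) : IsResolventOf (schrodinger m ε) (-α) (R ε) :=
      (hR ε).1.isResolventOf_neg (hR ε).2.1
    refine ⟨fun ε _ => ⟨R ε, hres ε⟩, ⟨fun ε => optimalBound m (betaParam α ε),
      tendsto_optimalBound_betaParam hm α, fun ε hε hsmall =>
        formBound_optimalBound_betaParam hα h hε hsmall⟩, C, fun ε hε hsmall η hη => ?_⟩
    rw [(hres ε).resolventOf_eq, (hres 0).resolventOf_eq]
    exact hC ε hε hsmall η hη
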